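/- For $0<\alpha<1$ and $t>0$ let $v_\alpha(t,\cdot)$ be the one-sided $\alpha$-stable density, $$v_\alpha(t,x)=\frac1{2\pi}\int_{-\infty}^{\infty}e^{-i\omega x}\exp\!\big(-t|\omega|^{\alpha}e^{-\frac{i\pi}{2}\alpha\,\mathrm{sgn}(\omega)}\big)\,d\omega ,$$ and let $h_{\alpha_1,\alpha_2}(t,x)=\int_0^x v_{\alpha_1}(t,y)\,v_{\alpha_2}(t,x-y)\,dy$ be the one-sided two-scale density. Let $l,k,p,q$ be positive integers with $\frac lk<1$, $\frac pq<1$ and $\frac lk\ne\frac pq$, and put $$m=\min\!\big(\tfrac lk,\tfrac pq\big),\quad M=\max\!\big(\tfrac lk,\tfrac pq\big),\quad m_1=\min(kp,lq).$$ Let $t>0$, $x>0$ and $$\kappa=\frac{(lp)^{lp}}{m_1^{m_1}}\Big(\frac{t^{1/M}}{x}\Big)^{lp}.$$ Write $\Delta(n,a)$ for the list $\frac an,\frac{a+1}n,\dots,\frac{a+n-1}n$, write $${}_PF_Q\Big({a_1,\dots,a_P\atop b_1,\dots,b_Q};z\Big)=\sum_{j=0}^\infty\frac{z^j}{j!}\frac{\prod_{i=1}^P(a_i)_j}{\prod_{i=1}^Q(b_i)_j},\qquad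 (a)_j=a(a+1)\cdots(a+j-1),$$ for the generalized hypergeometric function and, for $z>0$, $$G^{\mu,\nu}_{P,Q}\Big(z\Big|{A_1,\dots,A_P\atop B_1,\dots,B_Q}\Big)=\frac1{2\pi i}\int_{c-i\infty}^{c+i\infty}\frac{\prod_{j=1}^\mu\Gamma(B_j+s)\prod_{j=1}^\nu\Gamma(1-A_j-s)}{\prod_{j=\mu+1}^Q\Gamma(1-B_j-s)\prod_{j=\nu+1}^P\Gamma(A_j+s)}\,z^{-s}\,ds$$ for the Meijer function, where the line $\mathrm{Re}\,s=c$ has the poles of $\Gamma(B_j+s)$ $(j\le \mu)$ on its left and those of $\Gamma(1-A_j-s)$ $(j\le \nu)$ on its right. Then $$h_{\frac lk,\frac pq}(t,x)=-\frac1\pi\sum_{r=0}^\infty\sum_{n=0}^{m_1-1}\frac{(-t)^{n+r}}{n!\,r!}\,\frac{\Gamma(1+Mn+mr)}{x^{1+Mn+mr}}\,\sin(\pi Mn+\pi mr)\;{}_{1+lp}F_{m_1}\Big({1,\Delta(lp,1+Mn+mr)\atop\Delta(m_1,1+n)};(-1)^{m_1-lp}\kappa\Big)$$ and $$h_{\frac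 lk,\frac pq}(t,x)=\frac{x^{-1}m_1\sqrt M}{(2\pi)^{\frac{m_1-lp}2}}\sum_{r=0}^\infty\frac{(-t)^r}{r!}\Big(\frac{m_1}t\Big)^{\frac mM r}G^{m_1,0}_{lp,m_1}\Big(\kappa\Big|{\Delta(lp,0)\atop\Delta(m_1,\frac mM r)}\Big).$$ Both series over $r$ converge absolutely, every hypergeometric series that occurs converges absolutely, and for every Meijer function that occurs the contour integral converges absolutely, with a value that does not depend on the admissible $c$. -/

import Mathlib

noncomputable section

namespace TwoScaleLevy

/-- The uniform partition `Δ(n, a) = {a/n, (a+1)/n, …, (a+n-1)/n}`, as an `n`-tuple. -/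
def unifPart (n : ℕ) (a : ℝ) : Fin n → ℝ := fun s => (a + (s : ℕ)) / n

/-- The `j`-th term `x^j / j! * ∏ (a_i)_j / ∏ (b_i)_j` of the generalized hypergeometric
series, with `(a)_j = a (a+1) ⋯ (a+j-1)` the Pochhammer symbol. -/
def hypTerm {p q : ℕ} (a : Fin p → ℝ) (b : Fin q → ℝ) (x : ℝ) (j : ℕ) : ℝ :=
  x ^ j / (Nat.factorial j : ℝ) *
    ((∏ i, (ascPochhammer ℝ j).eval (a i)) / ∏ i, (ascPochhammer ℝ j).eval (b i))

/-- The generalized hypergeometric function `pFq(a; b; x)`. -/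
def hypF {p q : ℕ} (a : Fin p → ℝ) (b : Fin q → ℝ) (x : ℝ) : ℝ :=
  ∑' j : ℕ, hypTerm a b x j

/-- The quotient of products of gamma functions whose inverse Mellin transform is
`G^{m,n}_{p,q}(· | A; B)`. With 0-based indices, `j < m` stands for `1 ≤ j ≤ m`. -/
def meijerKernel {p q : ℕ} (m n : ℕ) (A : Fin p → ℂ) (B : Fin q → ℂ) (s : ℂ) : ℂ :=
  ((∏ j : Fin q with j.val < m, Complex.Gamma (B j + s)) *
      ∏ j : Fin p with j.val < n, Complex.Gamma (1 - A j - s)) /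
    ((∏ j : Fin q with m ≤ j.val, Complex.Gamma (1 - B j - s)) *
      ∏ j : Fin p with n ≤ j.val, Complex.Gamma (A j + s))

/-- The line `Re s = c` is an integration contour for `G^{m,n}_{p,q}`: it has the poles of the
`Γ(B_j + s)`, `j ≤ m`, on its left and those of the `Γ(1 - A_j - s)`, `j ≤ n`, on its right. -/
def IsMeijerContour {p q : ℕ} (m n : ℕ) (A : Fin p → ℂ) (B : Fin q → ℂ) (c : ℝ) : Prop :=
  (∀ j : Fin q, (j : ℕ) < m → -(B j).re < c) ∧
    ∀ j : Fin p, (j : ℕ) < n → c < 1 - (A j).re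

/-- The Meijer function `G^{m,n}_{p,q}(z | A; B)` for `z > 0`: the inverse Mellin transform of
`meijerKernel` along a vertical line that separates the two families of poles. It is used
together with `MeijerGConverges`, which says that such lines exist, and that the integral over
each of them converges absolutely, with a value independent of the line. -/
def meijerG {p q : ℕ} (m n : ℕ) (A : Fin p → ℂ) (B : Fin q → ℂ) (z : ℝ) : ℂ :=
  mellinInv (Classical.epsilon (IsMeijerContour m n A B)) (meijerKernel m n A B) z

/-- The contour integral that defines `G^{m,n}_{p,q}(z | A; B)` makes sense. -/
def MeijerGConverges {p q : ℕ} (m n : ℕ) (A : Fin p → ℂ) (B : Fin q → ℂ) (z : ℝ) : Prop :=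
  (∃ c : ℝ, IsMeijerContour m n A B c) ∧
    ∀ c : ℝ, IsMeijerContour m n A B c →
      Complex.VerticalIntegrable (meijerKernel m n A B) c ∧
        mellinInv c (meijerKernel m n A B) z = meijerG m n A B z

/-- The characteristic function (Fourier transform with kernel `e^{iωx}`) of the stable law with
parameters `α`, `β`, `γ` at time `t`: `exp(-t γ |ω|^α e^{(iπ/2) β sgn ω})`. -/
def stableCharFun (α β γ t ω : ℝ) : ℂ :=
  Complex.exp (-((t * γ * |ω| ^ α : ℝ) : ℂ) *
    Complex.exp (Complex.I * Real.pi / 2 * β * (Real.sign ω : ℝ)))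

/-- The stable density `v_{α,β,γ}(t, x)`: the inverse Fourier transform
`(1/2π) ∫ e^{-iωx} stableCharFun α β γ t ω dω`. The integral is real, since `stableCharFun` at
`-ω` is the complex conjugate of its value at `ω`. -/
def stableDensity (α β γ t x : ℝ) : ℝ :=
  (1 / (2 * (Real.pi : ℂ)) *
    ∫ ω : ℝ, Complex.exp (-(Complex.I * ω * x)) * stableCharFun α β γ t ω).re

/-- The one-sided stable density `v_α = v_{α,-α,1}`. -/
def oneSidedDensity (α t x : ℝ) : ℝ := stableDensity α (-α) 1 t x

/-- The one-sided two-scale density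
`h_{α₁,α₂}(t, x) = ∫_0^x v_{α₁}(t, y) v_{α₂}(t, x - y) dy` (Laplace convolution). -/
def twoScaleDensity (α₁ α₂ t x : ℝ) : ℝ :=
  ∫ y in (0 : ℝ)..x, oneSidedDensity α₁ t y * oneSidedDensity α₂ t (x - y)

end TwoScaleLevy

end

namespace TwoScaleLevy

open Filter Topology MeasureTheory
open scoped FourierTransform

/-! With `L = lp` and `K = m₁` one has `M * K = L`. The density `h` is the inverse Fourier transform
of the product of two stable characteristic functions. On the ray `s = -iω` this product is `e^{-t
s^M - t s^m}`, so `h` is `-1/π` times the imaginary part of an integral of `e^{xs - t s^M - t s^m}`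
along that ray. Because `0 < m, M < 1`, Cauchy's theorem allows the ray to be rotated. For `x < 0`
it turns to the positive half-line, where the integrand is real, so the density vanishes. For `x >
0` it turns to the negative half-line, where `e^{xs}` decays (`rayIntegral_eq`,
`rayIntegral_eq_pi`). One-sidedness reduces convolution over the line to convolution over `(0, x]`,
so the convolution theorem applies (`twoScaleDensity_eq_invCharFun`).

On the negative half-line both exponentials are expanded and integrated termwise against `e^{-xu}`.
This gives an absolutely convergent double series in powers `Mn + mr` (`hasSum_rayIntegral_pi`). For
fixed `r` the sum over `n` is the inverse Laplace transform `g_r` of `s^{mr} e^{-t s^M}`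
(`hasSum_invLaplace`), so both claimed formulas reduce to two evaluations of `g_r`.

Hypergeometric form: `n ↦ n + K` shifts the exponent `Mn` by the integer `L`. Along each residue
class modulo `K` the sine therefore only changes sign, and the Gamma quotients become Pochhammer
symbols (`coeff_mul_hypTerm`, `rayIntegral_eq_sum_hypF`).

Meijer form: after the change of variable `y = t^K / x^L`, the Mellin transform of `x g_r(x)` is, up
to a constant, `Γ(Ks + b) / Γ(Ls)` with `b = mr/M` (`hasMellin_invLaplace`). Since `L < K`, this
quotient decays exponentially on vertical lines, so Mellin inversion holds and the contour can be
moved freely (`exists_norm_gammaRatio_le`, `mellinInv_gammaRatio`). Gauss's multiplication formula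
turns it into the Meijer kernel with parameters `Δ(L, 0)`, `Δ(K, b)` and produces the factor `L^L /
K^K` of `κ` (`meijerKernel_unifPart`). -/

/-! ### Gauss's multiplication formula -/

/-- Multiplying each factor by `k` gives `kz + (j + k i)`, and `j + k i` takes every value below `k
N` exactly once. -/
theorem prod_range_prod_range_add_div {𝕜 : Type*} [Field 𝕜] [CharZero 𝕜] (k : ℕ) (hk : 0 < k)
    (z : 𝕜) (N : ℕ) :
    ∏ j ∈ Finset.range k, ∏ i ∈ Finset.range N, (z + (j : 𝕜) / k + i) =
      (∏ i ∈ Finset.range (k * N), ((k : 𝕜) * z + i)) / (k : 𝕜) ^ (k * N) := by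
  have hk' : (k : 𝕜) ≠ 0 := by exact_mod_cast hk.ne'
  induction N with
  | zero => simp
  | succ N ih =>
    simp only [Finset.prod_range_succ, Finset.prod_mul_distrib, ih, Nat.mul_succ,
      Finset.prod_range_add, pow_add]
    rw [mul_div_mul_comm]
    congr 1
    rw [eq_div_iff (pow_ne_zero _ hk')]
    have : (k : 𝕜) ^ k = ∏ _j ∈ Finset.range k, (k : 𝕜) := by simp
    rw [this, ← Finset.prod_mul_distrib]
    refine Finset.prod_congr rfl fun j _ => ?_
    push_cast
    field_simp
    ring

/-- Stirling's formula in the shape needed to compare a product of `d + 1` Euler sequences at `N`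
with a single one at `(d + 1) N`. -/
theorem tendsto_factorial_pow_div_factorial_mul (d : ℕ) :
    Tendsto (fun N : ℕ => √(N : ℝ) ^ d * (N.factorial : ℝ) ^ (d + 1) *
        ((d + 1 : ℕ) : ℝ) ^ ((d + 1) * N + (d + 1)) /
        ((((d + 1) * N).factorial : ℝ) * ((((d + 1) * N : ℕ) : ℝ)) ^ d))
      atTop (𝓝 (√(2 * Real.pi) ^ d * √((d + 1 : ℕ) : ℝ))) := by
  have hs := Stirling.tendsto_stirlingSeq_sqrt_pi
  have hm : Tendsto (fun N : ℕ => (d + 1) * N) atTop atTop :=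
    tendsto_id.const_mul_atTop' (Nat.succ_pos d)
  have hpi : √Real.pi ≠ 0 := (Real.sqrt_pos.2 Real.pi_pos).ne'
  -- Of the `d + 1` limits `√π` in the numerator one cancels against the denominator, leaving `√π ^
  -- d`; the missing powers of `√2` and `√(d + 1)` are put in by hand.
  have h1 := ((hs.pow (d + 1)).div (hs.comp hm) hpi).mul_const (√2 ^ d * √((d + 1 : ℕ) : ℝ))
  have e : √Real.pi ^ (d + 1) / √Real.pi * (√2 ^ d * √((d + 1 : ℕ) : ℝ)) =
      √(2 * Real.pi) ^ d * √((d + 1 : ℕ) : ℝ) := by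
    rw [Real.sqrt_mul (by norm_num), mul_pow]
    field_simp
    ring
  rw [e] at h1
  refine h1.congr' ?_
  filter_upwards [eventually_gt_atTop 0] with N hN
  have hN' : (0 : ℝ) < N := by exact_mod_cast hN
  simp only [Pi.div_apply, Function.comp_apply, Stirling.stirlingSeq]
  set K : ℝ := ((d + 1 : ℕ) : ℝ) with hK
  have hK0 : 0 < K := by positivity
  have hc : (((d + 1) * N : ℕ) : ℝ) = K * N := by rw [hK]; push_cast; ring
  rw [hc]
  have s1 : √(2 * (N : ℝ)) = √2 * √(N : ℝ) := Real.sqrt_mul (by norm_num) _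
  have s2 : √(2 * (K * (N : ℝ))) = √2 * (√K * √(N : ℝ)) := by
    rw [Real.sqrt_mul (by norm_num), Real.sqrt_mul hK0.le]
  rw [s1, s2]
  have q1 : (K * N / Real.exp 1) ^ ((d + 1) * N) =
      K ^ ((d + 1) * N) * ((N / Real.exp 1) ^ N) ^ (d + 1) := by
    rw [mul_div_assoc, mul_pow, ← pow_mul, mul_comm N]
  rw [q1]
  set E := (N / Real.exp 1) ^ N with hE
  have hE0 : 0 < E := by positivity
  have hKs : K = √K ^ 2 := (Real.sq_sqrt hK0.le).symm
  have hNs : (N : ℝ) = √(N : ℝ) ^ 2 := (Real.sq_sqrt hN'.le).symm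
  have hKp : 0 < √K := Real.sqrt_pos.2 hK0
  have hNp : 0 < √(N : ℝ) := Real.sqrt_pos.2 hN'
  have h2 : 0 < √(2 : ℝ) := by positivity
  have hf : (((d + 1) * N).factorial : ℝ) ≠ 0 := by positivity
  rw [hKs, hNs]
  simp only [Real.sqrt_sq hKp.le, Real.sqrt_sq hNp.le]
  generalize √K = κ at *
  generalize √(N : ℝ) = ν at *
  rw [div_pow, mul_pow, mul_pow]
  field_simp
  ring

/-- Gauss's multiplication formula for the Gamma function. -/
theorem prod_Gamma_add_div (k : ℕ) (hk : 0 < k) (z : ℂ) :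
    ∏ j ∈ Finset.range k, Complex.Gamma (z + (j : ℂ) / k) =
      ((√(2 * Real.pi) ^ (k - 1) * √(k : ℝ) : ℝ) : ℂ) * (k : ℂ) ^ (-((k : ℂ) * z)) *
        Complex.Gamma (k * z) := by
  obtain ⟨d, rfl⟩ : ∃ d, k = d + 1 := ⟨k - 1, by omega⟩
  set K : ℂ := ((d + 1 : ℕ) : ℂ) with hK
  have hK0 : K ≠ 0 := by rw [hK]; exact_mod_cast Nat.succ_ne_zero d
  have hm : Tendsto (fun N : ℕ => (d + 1) * N) atTop atTop :=
    tendsto_id.const_mul_atTop' (Nat.succ_pos d)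
  have hL : Tendsto (fun N : ℕ => ∏ j ∈ Finset.range (d + 1), Complex.GammaSeq (z + (j : ℂ) / K) N)
      atTop (𝓝 (∏ j ∈ Finset.range (d + 1), Complex.Gamma (z + (j : ℂ) / K))) :=
    tendsto_finsetProd _ fun j _ => Complex.GammaSeq_tendsto_Gamma _
  have hA := (Complex.continuous_ofReal.tendsto _).comp (tendsto_factorial_pow_div_factorial_mul d)
  have hB := (Complex.GammaSeq_tendsto_Gamma (K * z)).comp hm
  -- The `d + 1` sequences at `N` have `(d + 1)(N + 1)` linear factors in total, the single one at
  -- `(d + 1) N` only `(d + 1) N + 1`. The `d` surplus factors, divided by `(d + 1) N`, tend to one.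
  have hC : Tendsto (fun N : ℕ => ∏ i ∈ Finset.range d,
      (1 + (K * z + (i + 1)) / (((d + 1) * N : ℕ) : ℂ))) atTop (𝓝 (∏ i ∈ Finset.range d, 1)) := by
    refine tendsto_finsetProd _ fun i _ => ?_
    have h0 : Tendsto (fun N : ℕ => (K * z + (i + 1)) / (((d + 1) * N : ℕ) : ℂ)) atTop (𝓝 0) :=
      (tendsto_const_div_atTop_nhds_zero_nat (𝕜 := ℂ) (K * z + (i + 1))).comp hm
    simpa using h0.const_add 1
  have hR := ((hA.mul_const (K ^ (-(K * z)))).mul hB).div hC (by simp)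
  have := tendsto_nhds_unique (hL.congr' ?_) hR
  · simpa using this
  filter_upwards [eventually_gt_atTop 0] with N hN
  have hN' : (N : ℂ) ≠ 0 := by exact_mod_cast hN.ne'
  simp only [Pi.div_apply, Function.comp_apply, Complex.GammaSeq, Finset.prod_div_distrib,
    Finset.prod_mul_distrib, Finset.prod_const, Finset.card_range]
  rw [prod_range_prod_range_add_div (d + 1) (Nat.succ_pos d) z (N + 1)]
  have e1 : (d + 1) * (N + 1) = (d + 1) * N + 1 + d := by ring
  have e2 : ∏ i ∈ Finset.range d, (1 + (K * z + (i + 1)) / (((d + 1) * N : ℕ) : ℂ)) =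
      (∏ i ∈ Finset.range d, (K * z + (((d + 1) * N + 1 + i : ℕ) : ℂ))) /
        (((d + 1) * N : ℕ) : ℂ) ^ d := by
    have h0 : (((d + 1) * N : ℕ) : ℂ) ≠ 0 := by
      exact_mod_cast (Nat.mul_pos (Nat.succ_pos d) hN).ne'
    have : (((d + 1) * N : ℕ) : ℂ) ^ d =
      ∏ _i ∈ Finset.range d, (((d + 1) * N : ℕ) : ℂ) := by simp
    rw [this, ← Finset.prod_div_distrib]
    refine Finset.prod_congr rfl fun i _ => ?_
    rw [eq_div_iff h0, add_mul, div_mul_cancel₀ _ h0]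
    push_cast
    ring
  -- The offsets `j / (d + 1)` sum to `d / 2`, which is the source of `√N ^ d`.
  have e3 : ∏ j ∈ Finset.range (d + 1), (N : ℂ) ^ (z + (j : ℂ) / K) =
      (N : ℂ) ^ (K * z) * ((√(N : ℝ) : ℝ) : ℂ) ^ d := by
    have hs : ((√(N : ℝ) : ℝ) : ℂ) = Complex.exp (Complex.log N * (1 / 2)) := by
      rw [Real.sqrt_eq_rpow, Complex.ofReal_cpow (Nat.cast_nonneg N),
        Complex.cpow_def_of_ne_zero (by exact_mod_cast hN.ne')]
      push_cast
      rfl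
    simp only [Complex.cpow_def_of_ne_zero hN', hs]
    rw [← Complex.exp_sum, ← Complex.exp_nat_mul, ← Complex.exp_add]
    congr 1
    rw [← Finset.mul_sum, Finset.sum_add_distrib, ← Finset.sum_div, Finset.sum_const,
      Finset.card_range, nsmul_eq_mul]
    have hg : (∑ j ∈ Finset.range (d + 1), (j : ℂ)) * 2 = (d + 1 : ℂ) * d := by
      have := Finset.sum_range_id_mul_two (d + 1)
      have h' : (((∑ j ∈ Finset.range (d + 1), j) * 2 : ℕ) : ℂ) = (((d + 1) * d : ℕ) : ℂ) := by
        rw [this]; rfl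
      push_cast at h'
      exact h'
    have hg' : (∑ j ∈ Finset.range (d + 1), (j : ℂ)) / K = d / 2 := by
      rw [div_eq_iff hK0, hK]
      push_cast
      linear_combination hg / 2
    rw [hg']
    ring
  have e4 : (((d + 1) * N : ℕ) : ℂ) ^ (K * z) = K ^ (K * z) * (N : ℂ) ^ (K * z) := by
    rw [hK, Nat.cast_mul, Complex.natCast_mul_natCast_cpow]
  rw [e2, e3, e4, e1, Finset.prod_range_add, Complex.cpow_neg]
  have hf : (((d + 1) * N).factorial : ℂ) ≠ 0 := by exact_mod_cast Nat.factorial_ne_zero _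
  have hc1 : K ^ (K * z) ≠ 0 := by simp [Complex.cpow_eq_zero_iff, hK0]
  have hc2 : (N : ℂ) ^ (K * z) ≠ 0 := by simp [Complex.cpow_eq_zero_iff, hN']
  have hq : (((d + 1) * N : ℕ) : ℂ) ≠ 0 := by
    exact_mod_cast (Nat.mul_pos (Nat.succ_pos d) hN).ne'
  have hKr : (((d + 1 : ℕ) : ℝ) : ℂ) = K := by simp [hK]
  push_cast only [Complex.ofReal_div, Complex.ofReal_mul, Complex.ofReal_pow, hKr,
    Complex.ofReal_natCast]
  simp only [div_eq_mul_inv, mul_inv, inv_inv]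
  have h3 : K ^ ((d + 1) * N + 1 + d) = K ^ ((d + 1) * N + (d + 1)) := by ring_nf
  rw [h3]
  field_simp
  simp only [mul_comm z, ← hK]

/-! ### Rotating the ray of integration -/

/-- Cauchy's theorem for a horizontal strip: the integrals of `F` over its two sides agree. -/
theorem integral_eq_of_strip {F : ℂ → ℂ} {a b : ℝ} {g : ℝ → ℝ}
    (hF : DifferentiableOn ℂ F {z | z.im ∈ Set.uIcc a b})
    (hFg : ∀ y ∈ Set.uIcc a b, ∀ v : ℝ, ‖F (v + y * Complex.I)‖ ≤ g v)
    (hg : Integrable g) (htop : Tendsto g atTop (𝓝 0)) (hbot : Tendsto g atBot (𝓝 0)) :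
    ∫ v : ℝ, F (v + a * Complex.I) = ∫ v : ℝ, F (v + b * Complex.I) := by
  have hint : ∀ y ∈ Set.uIcc a b, Integrable fun v : ℝ => F (v + y * Complex.I) := by
    intro y hy
    refine hg.mono' (Continuous.aestronglyMeasurable ?_) (.of_forall (hFg y hy))
    refine hF.continuousOn.comp_continuous (by fun_prop) fun v => ?_
    simpa using hy
  have lim : ∀ y ∈ Set.uIcc a b, Tendsto (fun T : ℝ => ∫ v in (-T)..T, F (v + y * Complex.I))
      atTop (𝓝 (∫ v : ℝ, F (v + y * Complex.I))) := fun y hy =>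
    intervalIntegral_tendsto_integral (hint y hy) tendsto_neg_atTop_atBot tendsto_id
  have side : ∀ s : ℝ → ℝ, Tendsto (fun T => g (s T)) atTop (𝓝 0) →
      Tendsto (fun T : ℝ => ∫ y in a..b, F (s T + y * Complex.I)) atTop (𝓝 0) := by
    intro s hs
    refine squeeze_zero_norm (fun T => intervalIntegral.norm_integral_le_of_norm_le_const
      (C := g (s T)) fun y hy => hFg y (Set.uIoc_subset_uIcc hy) _) ?_
    simpa using hs.mul_const |b - a|
  -- Cauchy on the rectangle with vertical sides at `±T`; by `side` these sides contribute nothing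
  -- in the limit.
  have key : ∀ T : ℝ, (∫ v in (-T)..T, F (v + a * Complex.I)) -
      (∫ v in (-T)..T, F (v + b * Complex.I)) +
      Complex.I * (∫ y in a..b, F ((T : ℝ) + y * Complex.I)) -
      Complex.I * (∫ y in a..b, F ((-T : ℝ) + y * Complex.I)) = 0 := by
    intro T
    have := Complex.integral_boundary_rect_eq_zero_of_differentiableOn F
      (⟨-T, a⟩ : ℂ) (⟨T, b⟩ : ℂ) (hF.mono fun z hz => by
        rw [Complex.mem_reProdIm] at hz
        exact hz.2)
    simpa using this
  have l := (((lim a Set.left_mem_uIcc).sub (lim b Set.right_mem_uIcc)).add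
    ((side (fun T => T) htop).const_mul Complex.I)).sub
    ((side (fun T => -T) (hbot.comp tendsto_neg_atTop_atBot)).const_mul Complex.I)
  have := tendsto_nhds_unique (l.congr key) tendsto_const_nhds
  simpa [sub_eq_zero] using this

theorem image_exp_univ : Real.exp '' Set.univ = Set.Ioi 0 := by
  rw [Set.image_univ, Real.range_exp]

theorem integral_Ioi_eq_integral_exp (f : ℝ → ℂ) :
    ∫ u in Set.Ioi (0 : ℝ), f u = ∫ v : ℝ, (Real.exp v : ℂ) * f (Real.exp v) := by
  have := integral_image_eq_integral_abs_deriv_smul MeasurableSet.univ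
    (fun v _ => (Real.hasDerivAt_exp v).hasDerivWithinAt) Real.exp_injective.injOn f
  rw [image_exp_univ] at this
  simpa [abs_of_pos (Real.exp_pos _)] using this

theorem integrableOn_Ioi_iff_integrable_exp {E : Type*} [NormedAddCommGroup E]
    [NormedSpace ℝ E] (f : ℝ → E) :
    IntegrableOn f (Set.Ioi 0) ↔ Integrable fun v : ℝ => Real.exp v • f (Real.exp v) := by
  have := integrableOn_image_iff_integrableOn_abs_deriv_smul MeasurableSet.univ
    (fun v _ => (Real.hasDerivAt_exp v).hasDerivWithinAt) Real.exp_injective.injOn f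
  rw [image_exp_univ] at this
  simpa [abs_of_pos (Real.exp_pos _)] using this

/-- Sublinear powers are absorbed by any linear term: beyond the crossing point `U` of `B u^M` and
`A u` no constant is needed, and before it `B U^M` suffices. -/
theorem exists_mul_rpow_le {M : ℝ} (hM1 : M < 1) (hM0 : 0 < M) {A : ℝ} (hA : 0 < A) {B : ℝ}
    (hB : 0 ≤ B) : ∃ C : ℝ, ∀ u : ℝ, 0 ≤ u → B * u ^ M ≤ A * u + C := by
  set U : ℝ := (B / A) ^ (1 / (1 - M)) with hU
  have h1M : 0 < 1 - M := by linarith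
  have hU0 : 0 ≤ U := by positivity
  refine ⟨B * U ^ M, fun u hu => ?_⟩
  rcases le_or_gt u U with h | h
  · have : B * u ^ M ≤ B * U ^ M := by gcongr
    have : 0 ≤ A * u := by positivity
    linarith
  · have hu0 : 0 < u := hU0.trans_lt h
    have h2 : B / A ≤ u ^ (1 - M) := by
      calc B / A = U ^ (1 - M) := by
            rw [hU, ← Real.rpow_mul (by positivity), one_div_mul_cancel h1M.ne', Real.rpow_one]
        _ ≤ u ^ (1 - M) := by gcongr
    have h3 : u ^ (1 - M) * u ^ M = u := by
      rw [← Real.rpow_add hu0]; simp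
    have h4 : B ≤ A * u ^ (1 - M) := by rwa [div_le_iff₀' hA] at h2
    have h5 : B * u ^ M ≤ A * u ^ (1 - M) * u ^ M := by gcongr
    rw [mul_assoc, h3] at h5
    have : 0 ≤ B * U ^ M := by positivity
    linarith

/-- On the closed sector of angles `θ` where `e^{x s}`, `s = u e^{-iθ}`, is bounded, the real part
of the exponent `x s - t s^M - t' s^m` is uniformly dominated by `-ε u^M`. -/
theorem exists_phase_le {x t t' M m : ℝ} (ht : 0 < t) (ht' : 0 ≤ t') (hM0 : 0 < M) (hM1 : M < 1)
    (hm0 : 0 < m) (hm1 : m < 1) (hx : x ≠ 0) :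
    ∃ C ε : ℝ, 0 < ε ∧ ∀ θ ∈ Set.Icc 0 Real.pi, x * Real.cos θ ≤ 0 → ∀ u : ℝ, 0 ≤ u →
      x * u * Real.cos θ - t * u ^ M * Real.cos (M * θ) - t' * u ^ m * Real.cos (m * θ) ≤
        C - ε * u ^ M := by
  have hpi := Real.pi_pos
  -- The angle `θ₀ = κ π / 2` lies slightly beyond `π / 2`, yet `M θ₀` and `m θ₀` stay below `π /
  -- 2`. Up to `θ₀` the decay comes from `t s^M`; beyond it `cos θ` is bounded away from zero, which
  -- forces `x > 0`, and `e^{xs}` dominates both powers.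
  obtain ⟨κ, hκ1, hκM, hκm, hκ2⟩ : ∃ κ : ℝ, 1 < κ ∧ M * κ < 1 ∧ m * κ < 1 ∧ κ < 2 := by
    have h : (1 : ℝ) < min (min (1 / M) (1 / m)) 2 := by
      refine lt_min (lt_min ?_ ?_) one_lt_two
      · rwa [lt_div_iff₀ hM0, one_mul]
      · rwa [lt_div_iff₀ hm0, one_mul]
    obtain ⟨κ, h1, h2⟩ := exists_between h
    have h3 := h2.trans_le (min_le_left _ _)
    refine ⟨κ, h1, ?_, ?_, h2.trans_le (min_le_right _ _)⟩
    · have := h3.trans_le (min_le_left _ _)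
      rwa [lt_div_iff₀ hM0, mul_comm] at this
    · have := h3.trans_le (min_le_right _ _)
      rwa [lt_div_iff₀ hm0, mul_comm] at this
  set θ₀ : ℝ := κ * (Real.pi / 2) with hθ₀
  have hθ₀pi : θ₀ ≤ Real.pi := by nlinarith
  have hθ₀2 : Real.pi / 2 < θ₀ := by nlinarith
  have hMθ₀ : M * θ₀ < Real.pi / 2 := by
    rw [hθ₀, ← mul_assoc]; nlinarith
  have hmθ₀ : m * θ₀ < Real.pi / 2 := by
    rw [hθ₀, ← mul_assoc]; nlinarith
  have hθ₀0 : 0 < θ₀ := by positivity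
  set c₀ := Real.cos (M * θ₀) with hc₀
  have hc₀p : 0 < c₀ := Real.cos_pos_of_mem_Ioo ⟨by nlinarith, hMθ₀⟩
  set c₁ := Real.cos θ₀ with hc₁
  have hc₁n : c₁ < 0 := Real.cos_neg_of_pi_div_two_lt_of_lt hθ₀2 (by linarith)
  -- Each of the two powers may use half of the linear decay. The surplus `t * c₀` in the first
  -- absorption pays for the final `-ε u^M`.
  have hA : 0 < |x| * -c₁ / 2 := 
    div_pos (mul_pos (abs_pos.2 hx) (by linarith)) two_pos
  obtain ⟨C₁, hC₁⟩ := exists_mul_rpow_le hM1 hM0 hA (B := t + t * c₀) (by positivity)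
  obtain ⟨C₂, hC₂⟩ := exists_mul_rpow_le hm1 hm0 hA ht'
  refine ⟨max 0 (C₁ + C₂), t * c₀, by positivity, fun θ hθ hxθ u hu => ?_⟩
  have huM : 0 ≤ u ^ M := Real.rpow_nonneg hu _
  have hum : 0 ≤ u ^ m := Real.rpow_nonneg hu _
  rcases le_or_gt θ θ₀ with h | h
  · have h1 : c₀ ≤ Real.cos (M * θ) := by
      refine Real.cos_le_cos_of_nonneg_of_le_pi (mul_nonneg hM0.le hθ.1) (by linarith) ?_
      gcongr
    have h2 : 0 ≤ Real.cos (m * θ) := by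
      refine Real.cos_nonneg_of_mem_Icc ⟨?_, ?_⟩
      · have := mul_nonneg hm0.le hθ.1; linarith
      · have : m * θ ≤ m * θ₀ := by gcongr
        linarith
    have h3 : t * u ^ M * c₀ ≤ t * u ^ M * Real.cos (M * θ) := by gcongr
    have h4 : 0 ≤ t' * u ^ m * Real.cos (m * θ) := by positivity
    have h5 : x * u * Real.cos θ ≤ 0 := by nlinarith
    have h6 : (0 : ℝ) ≤ max 0 (C₁ + C₂) := le_max_left _ _
    nlinarith
  · have h1 : Real.cos θ ≤ c₁ := Real.cos_le_cos_of_nonneg_of_le_pi hθ₀0.le hθ.2 h.le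
    have hx0 : 0 < x := by
      by_contra hx'
      have : x < 0 := lt_of_le_of_ne (not_lt.1 hx') hx
      nlinarith
    have h2 : x * u * Real.cos θ ≤ x * u * c₁ := by gcongr
    have h3 : -(t * u ^ M * Real.cos (M * θ)) ≤ t * u ^ M := by
      have := Real.neg_one_le_cos (M * θ)
      have : 0 ≤ t * u ^ M := by positivity
      nlinarith
    have h4 : -(t' * u ^ m * Real.cos (m * θ)) ≤ t' * u ^ m := by
      have := Real.neg_one_le_cos (m * θ)
      have : 0 ≤ t' * u ^ m := by positivity
      nlinarith
    have h5 := hC₁ u hu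
    have h6 := hC₂ u hu
    rw [abs_of_pos hx0] at h5 h6
    have h7 : C₁ + C₂ ≤ max 0 (C₁ + C₂) := le_max_right _ _
    nlinarith

theorem integrable_exp_sub_exp {ρ M ε C : ℝ} (hρ : -1 < ρ) (hM0 : 0 < M) (hε : 0 < ε) :
    Integrable fun v : ℝ => Real.exp ((1 + ρ) * v + (C - ε * Real.exp v ^ M)) := by
  have h := (integrableOn_rpow_mul_exp_neg_mul_rpow (p := M) (s := ρ) hρ hM0 hε)
  rw [integrableOn_Ioi_iff_integrable_exp] at h
  refine (h.const_mul (Real.exp C)).congr (.of_forall fun v => ?_)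
  simp only [smul_eq_mul]
  rw [← Real.exp_mul v ρ, ← Real.exp_add, ← Real.exp_add, ← Real.exp_add]
  ring_nf

theorem tendsto_exp_sub_exp_atBot {ρ M ε C : ℝ} (hρ : -1 < ρ) (hε : 0 < ε) :
    Tendsto (fun v : ℝ => Real.exp ((1 + ρ) * v + (C - ε * Real.exp v ^ M))) atBot (𝓝 0) := by
  refine Real.tendsto_exp_atBot.comp ?_
  have h1 : Tendsto (fun v : ℝ => (1 + ρ) * v + C) atBot atBot :=
    tendsto_atBot_add_const_right _ _ (tendsto_id.const_mul_atBot (by linarith))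
  refine tendsto_atBot_mono (fun v => ?_) h1
  have : 0 ≤ ε * Real.exp v ^ M := by positivity
  linarith

theorem tendsto_exp_sub_exp_atTop {ρ M ε C : ℝ} (hM0 : 0 < M) (hε : 0 < ε) :
    Tendsto (fun v : ℝ => Real.exp ((1 + ρ) * v + (C - ε * Real.exp v ^ M))) atTop (𝓝 0) := by
  have h := tendsto_rpow_mul_exp_neg_mul_atTop_nhds_zero ((1 + ρ) / M) ε hε
  have h2 : Tendsto (fun v : ℝ => Real.exp (M * v)) atTop atTop :=
    Real.tendsto_exp_atTop.comp (tendsto_id.const_mul_atTop hM0)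
  have h3 := (h.comp h2).const_mul (Real.exp C)
  rw [mul_zero] at h3
  refine h3.congr fun v => ?_
  simp only [Function.comp_apply]
  rw [← Real.exp_mul, ← Real.exp_mul v M, ← Real.exp_add, ← Real.exp_add]
  congr 1
  field_simp
  ring

/-- The integrand `s^{1+ρ} e^{x s - t s^M - t' s^m}` in the logarithmic variable `s = e^w`. -/
noncomputable def logIntegrand (x t t' M m ρ : ℝ) (w : ℂ) : ℂ :=
  Complex.exp ((1 + ρ) * w + x * Complex.exp w - t * Complex.exp (M * w) -
    t' * Complex.exp (m * w))

/-- The integral of `s^ρ e^{x s - t s^M - t' s^m}` over the ray `arg s = -θ`. -/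
noncomputable def rayIntegral (x t t' M m ρ θ : ℝ) : ℂ :=
  ∫ v : ℝ, logIntegrand x t t' M m ρ (v + (-θ : ℝ) * Complex.I)

theorem differentiable_logIntegrand (x t t' M m ρ : ℝ) :
    Differentiable ℂ (logIntegrand x t t' M m ρ) := by
  unfold logIntegrand
  fun_prop

theorem norm_logIntegrand (x t t' M m ρ v θ : ℝ) :
    ‖logIntegrand x t t' M m ρ (v + (-θ : ℝ) * Complex.I)‖ =
      Real.exp ((1 + ρ) * v + (x * Real.exp v * Real.cos θ -
        t * Real.exp v ^ M * Real.cos (M * θ) - t' * Real.exp v ^ m * Real.cos (m * θ))) := by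
  rw [logIntegrand, Complex.norm_exp]
  congr 1
  simp only [Complex.sub_re, Complex.add_re, Complex.mul_re, Complex.exp_re, Complex.add_im,
    Complex.mul_im, Complex.ofReal_re, Complex.ofReal_im, Complex.I_re, Complex.I_im,
    Complex.one_re, Complex.one_im]
  rw [← Real.exp_mul, ← Real.exp_mul]
  simp
  ring_nf

theorem exists_dominating {x t t' M m ρ : ℝ} (ht : 0 < t) (ht' : 0 ≤ t') (hM0 : 0 < M)
    (hM1 : M < 1) (hm0 : 0 < m) (hm1 : m < 1) (hx : x ≠ 0) (hρ : 0 ≤ ρ) :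
    ∃ g : ℝ → ℝ, (∀ θ ∈ Set.Icc 0 Real.pi, x * Real.cos θ ≤ 0 → ∀ v : ℝ,
      ‖logIntegrand x t t' M m ρ (v + (-θ : ℝ) * Complex.I)‖ ≤ g v) ∧
      Integrable g ∧ Tendsto g atTop (𝓝 0) ∧ Tendsto g atBot (𝓝 0) := by
  obtain ⟨C, ε, hε, h⟩ := exists_phase_le ht ht' hM0 hM1 hm0 hm1 hx
  refine ⟨fun v => Real.exp ((1 + ρ) * v + (C - ε * Real.exp v ^ M)), fun θ hθ hxθ v => ?_,
    integrable_exp_sub_exp (by linarith) hM0 hε, tendsto_exp_sub_exp_atTop hM0 hε,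
    tendsto_exp_sub_exp_atBot (by linarith) hε⟩
  rw [norm_logIntegrand]
  exact Real.exp_le_exp.2 (add_le_add le_rfl (h θ hθ hxθ _ (Real.exp_pos v).le))

/-- In the variable `w = log s` rays become horizontal lines, so a rotation is a vertical shift. The
condition `x cos θ ≤ 0` makes the dominating function uniform over the strip. -/
theorem rayIntegral_eq {x t t' M m ρ : ℝ} (ht : 0 < t) (ht' : 0 ≤ t') (hM0 : 0 < M)
    (hM1 : M < 1) (hm0 : 0 < m) (hm1 : m < 1) (hx : x ≠ 0) (hρ : 0 ≤ ρ) {θ₁ θ₂ : ℝ}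
    (hθ : ∀ θ ∈ Set.uIcc θ₁ θ₂, θ ∈ Set.Icc 0 Real.pi ∧ x * Real.cos θ ≤ 0) :
    rayIntegral x t t' M m ρ θ₁ = rayIntegral x t t' M m ρ θ₂ := by
  obtain ⟨g, hg, hgi, h1, h2⟩ := exists_dominating (ρ := ρ) ht ht' hM0 hM1 hm0 hm1 hx hρ
  refine integral_eq_of_strip (g := g) (differentiable_logIntegrand x t t' M m ρ).differentiableOn ?_
    hgi h1 h2
  intro y hy v
  have hy' : -y ∈ Set.uIcc θ₁ θ₂ := by
    rw [Set.mem_uIcc] at hy ⊢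
    rcases hy with hy | hy
    · right; constructor <;> linarith
    · left; constructor <;> linarith
  have := hg (-y) (hθ _ hy').1 (hθ _ hy').2 v
  simpa using this

/-- The integrand `s^ρ e^{x s - t s^M - t' s^m} ds/du` on the ray `s = u e^{-iθ}`. -/
noncomputable def rayIntegrand (x t t' M m ρ θ u : ℝ) : ℂ :=
  Complex.exp (-(Complex.I * θ * (1 + ρ))) * (u ^ ρ : ℝ) *
    Complex.exp (x * u * Complex.exp (-(Complex.I * θ)) -
      t * (u ^ M : ℝ) * Complex.exp (-(Complex.I * (M * θ))) -
      t' * (u ^ m : ℝ) * Complex.exp (-(Complex.I * (m * θ))))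

theorem logIntegrand_eq (x t t' M m ρ θ v : ℝ) :
    logIntegrand x t t' M m ρ (v + (-θ : ℝ) * Complex.I) =
      (Real.exp v : ℂ) * rayIntegrand x t t' M m ρ θ (Real.exp v) := by
  rw [logIntegrand, rayIntegrand, ← Real.exp_mul, ← Real.exp_mul, ← Real.exp_mul]
  simp only [Complex.ofReal_exp]
  rw [← Complex.exp_add, ← Complex.exp_add, ← Complex.exp_add]
  have e : ∀ a : ℝ, Complex.exp ((v * a : ℝ) : ℂ) * Complex.exp (-(Complex.I * (a * θ))) =
      Complex.exp (a * (v + (-θ : ℝ) * Complex.I)) := by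
    intro a
    rw [← Complex.exp_add]
    congr 1
    push_cast
    ring
  have e1 : Complex.exp (v : ℂ) * Complex.exp (-(Complex.I * θ)) =
      Complex.exp (v + (-θ : ℝ) * Complex.I) := by
    simpa using e 1
  rw [mul_assoc (x : ℂ), e1, mul_assoc (t : ℂ), e, mul_assoc (t' : ℂ), e]
  congr 1
  push_cast
  ring

theorem rayIntegral_eq_integral_Ioi (x t t' M m ρ θ : ℝ) :
    rayIntegral x t t' M m ρ θ = ∫ u in Set.Ioi (0 : ℝ), rayIntegrand x t t' M m ρ θ u := by
  rw [integral_Ioi_eq_integral_exp, rayIntegral]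
  simp only [logIntegrand_eq]

/-! ### Characteristic functions as ray integrals -/

/-- The product of the characteristic functions of two one-sided stable laws. -/
noncomputable def twoScaleCharFun (t t' M m ω : ℝ) : ℂ :=
  stableCharFun M (-M) 1 t ω * stableCharFun m (-m) 1 t' ω

theorem norm_stableCharFun_le {M t : ℝ} (ht : 0 ≤ t) (ω : ℝ) :
    ‖stableCharFun M (-M) 1 t ω‖ ≤ Real.exp (-(t * Real.cos (M * (Real.pi / 2))) * |ω| ^ M) := by
  rw [stableCharFun, Complex.norm_exp]
  refine Real.exp_le_exp.2 ?_
  have h0 : 0 ≤ t * |ω| ^ M := by positivity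
  have e : Complex.exp (Complex.I * Real.pi / 2 * ((-M : ℝ) : ℂ) * (Real.sign ω : ℝ)) =
      Complex.exp ((-(M * (Real.pi / 2) * Real.sign ω) : ℝ) * Complex.I) := by
    congr 1; push_cast; ring
  rw [e, ← Complex.ofReal_neg, Complex.re_ofReal_mul, Complex.exp_ofReal_mul_I_re, Real.cos_neg]
  -- Equality for `ω ≠ 0`; the inequality is there for the value `Real.sign 0 = 0`.
  have h1 : Real.cos (M * (Real.pi / 2)) ≤ Real.cos (M * (Real.pi / 2) * Real.sign ω) := by
    rcases Real.sign_apply_eq ω with h | h | h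
    · rw [h]; simp
    · rw [h]; simpa using Real.cos_le_one _
    · rw [h]; simp
  nlinarith

/-- The only discontinuity of the phase is the jump of the sign at the origin, where the bounded
jump is multiplied by `|ω|^M → 0`. -/
theorem continuous_stableCharFun {M : ℝ} (hM : 0 < M) (t : ℝ) :
    Continuous fun ω => stableCharFun M (-M) 1 t ω := by
  have hpow : Continuous fun ω : ℝ => |ω| ^ M :=
    continuous_abs.rpow_const fun _ => Or.inr hM.le
  set S : ℝ → ℂ := fun ω =>
    Complex.exp (Complex.I * Real.pi / 2 * ((-M : ℝ) : ℂ) * (Real.sign ω : ℝ)) with hS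
  have hSn : ∀ ω, ‖S ω‖ ≤ 1 := by
    intro ω
    have e : S ω = Complex.exp ((-(M * (Real.pi / 2) * Real.sign ω) : ℝ) * Complex.I) := by
      simp only [hS]; congr 1; push_cast; ring
    rw [e, Complex.norm_exp_ofReal_mul_I]
  have key : Continuous fun ω : ℝ => ((|ω| ^ M : ℝ) : ℂ) * S ω := by
    refine continuous_iff_continuousAt.2 fun ω => ?_
    rcases eq_or_ne ω 0 with rfl | hω
    · have h0 : Tendsto (fun ω : ℝ => |ω| ^ M) (𝓝 0) (𝓝 0) := by
        have := hpow.tendsto 0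
        simpa [Real.zero_rpow hM.ne'] using this
      rw [ContinuousAt, abs_zero, Real.zero_rpow hM.ne', Complex.ofReal_zero, zero_mul]
      refine squeeze_zero_norm (fun ω => ?_) h0
      rw [norm_mul, Complex.norm_real, Real.norm_of_nonneg (by positivity)]
      exact mul_le_of_le_one_right (by positivity) (hSn ω)
    · have hc : ContinuousAt S ω := by
        rcases hω.lt_or_gt with h | h
        · refine (continuousAt_const (y := S (-1))).congr ?_
          filter_upwards [eventually_lt_nhds h] with y hy
          simp only [hS, Real.sign_of_neg hy, Real.sign_of_neg (show (-1 : ℝ) < 0 by norm_num)]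
        · refine (continuousAt_const (y := S 1)).congr ?_
          filter_upwards [eventually_gt_nhds h] with y hy
          simp only [hS, Real.sign_of_pos hy, Real.sign_of_pos one_pos]
      exact (Complex.continuous_ofReal.comp hpow).continuousAt.mul hc
  have : (fun ω => stableCharFun M (-M) 1 t ω) =
      fun ω => Complex.exp (-(t : ℂ) * (((|ω| ^ M : ℝ) : ℂ) * S ω)) := by
    funext ω
    simp only [stableCharFun, hS]
    congr 1
    push_cast
    ring
  rw [this]
  fun_prop

theorem cos_mul_pi_div_two_pos {M : ℝ} (hM0 : 0 < M) (hM1 : M < 1) :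
    0 < Real.cos (M * (Real.pi / 2)) := by
  have := Real.pi_pos
  exact Real.cos_pos_of_mem_Ioo ⟨by nlinarith, by nlinarith⟩

theorem integrable_exp_neg_mul_abs_rpow {M c : ℝ} (hM : 0 < M) (hc : 0 < c) :
    Integrable fun ω : ℝ => Real.exp (-c * |ω| ^ M) := by
  have h := integrableOn_rpow_mul_exp_neg_mul_rpow (p := M) (s := 0) (by norm_num) hM hc
  have h1 : IntegrableOn (fun ω : ℝ => Real.exp (-c * |ω| ^ M)) (Set.Ioi 0) :=
    h.congr_fun (fun ω hω => by simp [abs_of_pos (Set.mem_Ioi.1 hω)]) measurableSet_Ioi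
  have h2 : IntegrableOn (fun ω : ℝ => Real.exp (-c * |ω| ^ M)) (Set.Iic 0) := by
    have hme : MeasurableEmbedding fun x : ℝ => -x := (Homeomorph.neg ℝ).measurableEmbedding
    rw [← Measure.map_neg_eq_self (volume : Measure ℝ), hme.integrableOn_map_iff]
    simp_rw [Function.comp_def, abs_neg, Set.neg_preimage, Set.neg_Iic, neg_zero]
    exact Iff.mpr integrableOn_Ici_iff_integrableOn_Ioi h1
  rw [← integrableOn_univ, ← Set.Iic_union_Ioi (a := (0 : ℝ))]
  exact h2.union h1

section

variable {t t' M m : ℝ}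

theorem norm_twoScaleCharFun_le (ht : 0 ≤ t) (ht' : 0 ≤ t') (hm0 : 0 < m) (hm1 : m < 1) (ω : ℝ) :
    ‖twoScaleCharFun t t' M m ω‖ ≤
      Real.exp (-(t * Real.cos (M * (Real.pi / 2))) * |ω| ^ M) := by
  rw [twoScaleCharFun, norm_mul]
  refine (mul_le_mul (norm_stableCharFun_le ht ω) (norm_stableCharFun_le ht' ω)
    (norm_nonneg _) (by positivity)).trans ?_
  refine mul_le_of_le_one_right (by positivity) (Real.exp_le_one_iff.2 ?_)
  have := cos_mul_pi_div_two_pos hm0 hm1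
  have : 0 ≤ t' * Real.cos (m * (Real.pi / 2)) * |ω| ^ m := by positivity
  linarith

theorem continuous_twoScaleCharFun (hM0 : 0 < M) (hm0 : 0 < m) :
    Continuous (twoScaleCharFun t t' M m) :=
  (continuous_stableCharFun hM0 t).mul (continuous_stableCharFun hm0 t')

theorem integrable_twoScaleCharFun (ht : 0 < t) (ht' : 0 ≤ t') (hM0 : 0 < M) (hM1 : M < 1)
    (hm0 : 0 < m) (hm1 : m < 1) : Integrable (twoScaleCharFun t t' M m) := by
  have hc := mul_pos ht (cos_mul_pi_div_two_pos hM0 hM1)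
  exact (integrable_exp_neg_mul_abs_rpow hM0 hc).mono'
    (continuous_twoScaleCharFun hM0 hm0).aestronglyMeasurable
    (.of_forall (norm_twoScaleCharFun_le ht.le ht' hm0 hm1))

theorem twoScaleCharFun_neg (ω : ℝ) :
    twoScaleCharFun t t' M m (-ω) = (starRingEnd ℂ) (twoScaleCharFun t t' M m ω) := by
  have h : ∀ α t ω : ℝ, stableCharFun α (-α) 1 t (-ω) =
      (starRingEnd ℂ) (stableCharFun α (-α) 1 t ω) := by
    intro α t ω
    simp only [stableCharFun, ← Complex.exp_conj, map_mul, map_neg, abs_neg, Real.sign_neg,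
      Complex.conj_ofReal, map_div₀, Complex.conj_I, map_ofNat]
    congr 3
    push_cast
    ring
  rw [twoScaleCharFun, h, h, ← map_mul, twoScaleCharFun]

/-- Substitute `s = -iω = ω e^{-iπ/2}`: then `s^M = ω^M e^{-iπM/2}`, and the factor `i` undoes
`ds/dω = -i`. -/
theorem exp_mul_twoScaleCharFun (x : ℝ) {ω : ℝ} (hω : 0 < ω) :
    Complex.exp (-(Complex.I * ω * x)) * twoScaleCharFun t t' M m ω =
      Complex.I * rayIntegrand x t t' M m 0 (Real.pi / 2) ω := by
  have hI : Complex.exp (-(Complex.I * ((Real.pi / 2 : ℝ) : ℂ))) = -Complex.I := by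
    rw [Complex.exp_neg, mul_comm]
    push_cast
    rw [Complex.exp_pi_div_two_mul_I, Complex.inv_I]
  rw [twoScaleCharFun, stableCharFun, stableCharFun, rayIntegrand, Real.sign_of_pos hω,
    abs_of_pos hω, ← Complex.exp_add, ← Complex.exp_add]
  simp only [Complex.ofReal_zero, add_zero, mul_one, Real.rpow_zero, Complex.ofReal_one, hI]
  rw [← mul_assoc, mul_neg, Complex.I_mul_I, neg_neg, one_mul]
  congr 1
  have e : ∀ a : ℝ, Complex.I * Real.pi / 2 * ((-a : ℝ) : ℂ) =
      -(Complex.I * (a * ((Real.pi / 2 : ℝ) : ℂ))) := by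
    intro a; push_cast; ring
  rw [e, e]
  push_cast
  ring

/-- Negative frequencies contribute the conjugate of the positive ones, so the whole integral is `2
Re (i J) = -2 Im J`, with `J` the integral over the ray `arg s = -π/2`. -/
theorem integral_exp_mul_twoScaleCharFun (ht : 0 < t) (ht' : 0 ≤ t') (hM0 : 0 < M) (hM1 : M < 1)
    (hm0 : 0 < m) (hm1 : m < 1) (x : ℝ) :
    1 / (2 * (Real.pi : ℂ)) *
      ∫ ω : ℝ, Complex.exp (-(Complex.I * ω * x)) * twoScaleCharFun t t' M m ω =
      ((-(1 / Real.pi) * (rayIntegral x t t' M m 0 (Real.pi / 2)).im : ℝ) : ℂ) := by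
  set f : ℝ → ℂ := fun ω => Complex.exp (-(Complex.I * ω * x)) * twoScaleCharFun t t' M m ω with hf
  have hfi : Integrable f := by
    refine (integrable_twoScaleCharFun ht ht' hM0 hM1 hm0 hm1).mono
      (Continuous.aestronglyMeasurable ?_) (.of_forall fun ω => ?_)
    · have := continuous_twoScaleCharFun (t := t) (t' := t') hM0 hm0
      fun_prop
    · have : -(Complex.I * ω * x) = ((-(ω * x) : ℝ) : ℂ) * Complex.I := by push_cast; ring
      rw [hf, norm_mul, this, Complex.norm_exp_ofReal_mul_I, one_mul]
  have hneg : ∀ ω, f (-ω) = (starRingEnd ℂ) (f ω) := by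
    intro ω
    simp only [hf, twoScaleCharFun_neg, map_mul, ← Complex.exp_conj]
    congr 2
    simp
  have h1 : ∫ ω : ℝ, f ω = (∫ ω in Set.Ioi (0 : ℝ), f ω) +
      (starRingEnd ℂ) (∫ ω in Set.Ioi (0 : ℝ), f ω) := by
    rw [← intervalIntegral.integral_Iic_add_Ioi (b := (0 : ℝ)) hfi.integrableOn hfi.integrableOn,
      add_comm, ← integral_conj]
    congr 1
    have := integral_comp_neg_Ioi (0 : ℝ) f
    rw [neg_zero] at this
    rw [← this]
    simp only [hneg]
  have h2 : ∫ ω in Set.Ioi (0 : ℝ), f ω =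
      Complex.I * rayIntegral x t t' M m 0 (Real.pi / 2) := by
    rw [rayIntegral_eq_integral_Ioi, ← integral_const_mul]
    exact setIntegral_congr_fun measurableSet_Ioi fun ω hω => exp_mul_twoScaleCharFun x hω
  rw [h1, h2, Complex.add_conj]
  have hpi : (Real.pi : ℂ) ≠ 0 := by exact_mod_cast Real.pi_ne_zero
  push_cast [Complex.I_mul_re]
  field_simp

/-- The integrand is real on the positive half-line. No convergence is needed, since a divergent
integral is `0` on both sides by convention. -/
theorem rayIntegral_zero_im (x t t' M m ρ : ℝ) : (rayIntegral x t t' M m ρ 0).im = 0 := by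
  have : rayIntegral x t t' M m ρ 0 = ((∫ u in Set.Ioi (0 : ℝ), u ^ ρ *
      Real.exp (x * u - t * u ^ M - t' * u ^ m) : ℝ) : ℂ) := by
    rw [rayIntegral_eq_integral_Ioi, ← integral_complex_ofReal]
    refine integral_congr_ae (.of_forall fun u => ?_)
    simp [rayIntegrand]
  rw [this, Complex.ofReal_im]

/-- For `x < 0` the ray may be turned to the positive half-line; this is what makes the densities
one-sided. -/
theorem rayIntegral_pi_div_two_im_of_neg (ht : 0 < t) (ht' : 0 ≤ t') (hM0 : 0 < M) (hM1 : M < 1)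
    (hm0 : 0 < m) (hm1 : m < 1) {x ρ : ℝ} (hρ : 0 ≤ ρ) (hx : x < 0) :
    (rayIntegral x t t' M m ρ (Real.pi / 2)).im = 0 := by
  rw [rayIntegral_eq ht ht' hM0 hM1 hm0 hm1 hx.ne hρ (θ₂ := 0), rayIntegral_zero_im]
  intro θ hθ
  have hpi := Real.pi_pos
  rw [Set.uIcc_of_ge (by positivity)] at hθ
  have hc := Real.cos_nonneg_of_mem_Icc ⟨by linarith [hθ.1], hθ.2⟩
  exact ⟨⟨hθ.1, by linarith [hθ.2]⟩, by nlinarith⟩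

theorem rayIntegral_eq_pi (ht : 0 < t) (ht' : 0 ≤ t') (hM0 : 0 < M) (hM1 : M < 1)
    (hm0 : 0 < m) (hm1 : m < 1) {x ρ : ℝ} (hρ : 0 ≤ ρ) (hx : 0 < x) {θ : ℝ}
    (hθ : θ ∈ Set.Icc (Real.pi / 2) Real.pi) :
    rayIntegral x t t' M m ρ θ = rayIntegral x t t' M m ρ Real.pi := by
  refine rayIntegral_eq ht ht' hM0 hM1 hm0 hm1 hx.ne' hρ ?_
  intro φ hφ
  have hpi := Real.pi_pos
  rw [Set.uIcc_of_le hθ.2] at hφ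
  have hc := Real.cos_nonpos_of_pi_div_two_le_of_le (hθ.1.trans hφ.1) (by linarith [hφ.2])
  exact ⟨⟨by linarith [hφ.1, hθ.1], hφ.2⟩, by nlinarith⟩

end

/-! ### The two-scale density as a ray integral -/

/-- The convolution of two Fourier transforms is the Fourier transform of the product. -/
theorem integral_fourier_mul_fourier_sub {f g : ℝ → ℂ} (hfc : Continuous f) (hf : Integrable f)
    (hg : Integrable g) (hF : Integrable (𝓕 f)) (x : ℝ) :
    ∫ y : ℝ, 𝓕 f y * 𝓕 g (x - y) = 𝓕 (fun v => f v * g v) x := by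
  have hinv := hfc.fourierInv_fourier_eq hf hF
  have key : ∀ y v : ℝ, 𝓕 f y * (Complex.exp (↑(-2 * Real.pi * v * (x - y)) * Complex.I) * g v) =
      (Complex.exp (↑(-2 * Real.pi * v * x) * Complex.I) * g v) *
        (Complex.exp (↑(2 * Real.pi * (y * v)) * Complex.I) * 𝓕 f y) := by
    intro y v
    have : Complex.exp (↑(-2 * Real.pi * v * (x - y)) * Complex.I) =
        Complex.exp (↑(-2 * Real.pi * v * x) * Complex.I) *
          Complex.exp (↑(2 * Real.pi * (y * v)) * Complex.I) := by
      rw [← Complex.exp_add]; congr 1; push_cast; ring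
    rw [this]; ring
  have hint : Integrable (Function.uncurry fun y v : ℝ =>
      𝓕 f y * (Complex.exp (↑(-2 * Real.pi * v * (x - y)) * Complex.I) * g v))
      (volume.prod volume) := by
    have h1 := hF.mul_prod hg
    have h2 : Continuous fun p : ℝ × ℝ =>
        Complex.exp (↑(-2 * Real.pi * p.2 * (x - p.1)) * Complex.I) := by fun_prop
    refine (h1.bdd_mul (c := 1) h2.aestronglyMeasurable (.of_forall fun p => ?_)).congr
      (.of_forall fun p => ?_)
    · rw [Complex.norm_exp_ofReal_mul_I]
    · simp only [Function.uncurry]; ring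
  calc ∫ y : ℝ, 𝓕 f y * 𝓕 g (x - y)
      = ∫ y : ℝ, ∫ v : ℝ,
          𝓕 f y * (Complex.exp (↑(-2 * Real.pi * v * (x - y)) * Complex.I) * g v) := by
        refine integral_congr_ae (.of_forall fun y => ?_)
        simp only
        rw [integral_const_mul, Real.fourier_real_eq_integral_exp_smul g]
        simp only [smul_eq_mul]
    _ = ∫ v : ℝ, ∫ y : ℝ,
          𝓕 f y * (Complex.exp (↑(-2 * Real.pi * v * (x - y)) * Complex.I) * g v) :=
        integral_integral_swap hint
    _ = 𝓕 (fun v => f v * g v) x := by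
        rw [Real.fourier_real_eq_integral_exp_smul]
        refine integral_congr_ae (.of_forall fun v => ?_)
        simp only [key]
        rw [integral_const_mul]
        -- After the exchange of integrals, the inner one is Fourier inversion for `f`; this is why
        -- `𝓕 f` has to be integrable.
        have h3 : ∫ y : ℝ, Complex.exp (↑(2 * Real.pi * (y * v)) * Complex.I) * 𝓕 f y = f v := by
          conv_rhs => rw [← hinv, Real.fourierInv_eq']
          refine integral_congr_ae (.of_forall fun y => ?_)
          simp [mul_comm v y]
        rw [h3, smul_eq_mul]
        ring

theorem fourier_comp_two_pi_mul (f : ℝ → ℂ) (x : ℝ) :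
    𝓕 (fun η : ℝ => f (2 * Real.pi * η)) x =
      1 / (2 * (Real.pi : ℂ)) * ∫ ω : ℝ, Complex.exp (-(Complex.I * ω * x)) * f ω := by
  rw [Real.fourier_real_eq_integral_exp_smul]
  have := Measure.integral_comp_mul_left
    (fun ω : ℝ => Complex.exp (-(Complex.I * ω * x)) * f ω) (2 * Real.pi)
  rw [abs_of_pos (by positivity), Complex.real_smul] at this
  push_cast at this
  rw [one_div, ← this]
  refine integral_congr_ae (.of_forall fun v => ?_)
  simp only [smul_eq_mul]
  congr 2
  push_cast
  ring

section

variable {t M : ℝ}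

/-- On the negative half-line the imaginary part of the integrand carries the factor `sin (t u^M sin
πM) = O(u^M)`, which gains `x^{-M}` over the trivial bound `O(1/x)`. This gives the stable density
an integrable tail. -/
theorem rayIntegral_pi_im_bound (ht : 0 < t) (hM0 : 0 < M) (hM1 : M < 1) (m : ℝ) :
    ∃ C : ℝ, ∀ x : ℝ, 1 ≤ x → |(rayIntegral x t 0 M m 0 Real.pi).im| ≤ C * x ^ (-1 - M) := by
  -- For `x ≥ 1` half of `x u` is at least `u / 2`, so one constant serves all these `x`.
  obtain ⟨C, hC⟩ := exists_mul_rpow_le hM1 hM0 (A := 1 / 2) (by norm_num) ht.le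
  refine ⟨t * Real.exp C * (2 ^ (1 + M) * Real.Gamma (1 + M)), fun x hx => ?_⟩
  have hx0 : 0 < x := by linarith
  have him : (rayIntegral x t 0 M m 0 Real.pi).im =
      (∫ u in Set.Ioi (0 : ℝ), rayIntegrand x t 0 M m 0 Real.pi u).im := by
    rw [rayIntegral_eq_integral_Ioi]
  have hI : IntegrableOn (fun u : ℝ => u ^ (1 + M - 1) * Real.exp (-(x / 2 * u))) (Set.Ioi 0) := by
    have := integrableOn_rpow_mul_exp_neg_mul_rpow (p := 1) (s := 1 + M - 1) (b := x / 2)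
      (by linarith) one_pos (by linarith)
    simpa using this
  have hle : ∀ u ∈ Set.Ioi (0 : ℝ), |(rayIntegrand x t 0 M m 0 Real.pi u).im| ≤
      t * Real.exp C * (u ^ (1 + M - 1) * Real.exp (-(x / 2 * u))) := by
    intro u hu
    have hu0 : 0 < u := hu
    have hpiI : Complex.exp (-(Complex.I * (Real.pi : ℂ))) = -1 := by
      rw [Complex.exp_neg, mul_comm, Complex.exp_pi_mul_I]; norm_num
    have e : rayIntegrand x t 0 M m 0 Real.pi u =
        -Complex.exp (((-(x * u) - t * u ^ M * Real.cos (M * Real.pi) : ℝ) : ℂ) +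
          ((t * u ^ M * Real.sin (M * Real.pi) : ℝ) : ℂ) * Complex.I) := by
      rw [rayIntegrand]
      simp only [Complex.ofReal_zero, add_zero, mul_one, Real.rpow_zero, Complex.ofReal_one, hpiI,
        zero_mul, sub_zero, neg_mul, one_mul, mul_neg]
      congr 2
      have : -(Complex.I * ((M : ℂ) * Real.pi)) = ((-(M * Real.pi) : ℝ) : ℂ) * Complex.I := by
        push_cast; ring
      rw [this, Complex.exp_mul_I, ← Complex.ofReal_cos, ← Complex.ofReal_sin, Real.cos_neg,
        Real.sin_neg]
      push_cast
      ring
    rw [e, Complex.neg_im, abs_neg, Complex.exp_add, ← Complex.ofReal_exp, Complex.im_ofReal_mul,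
      Complex.exp_ofReal_mul_I_im, abs_mul, abs_of_pos (Real.exp_pos _)]
    have huM : 0 ≤ u ^ M := by positivity
    have h1 : |Real.sin (t * u ^ M * Real.sin (M * Real.pi))| ≤ t * u ^ M := by
      refine (Real.abs_sin_le_abs).trans ?_
      rw [abs_mul, abs_of_nonneg (by positivity)]
      exact mul_le_of_le_one_right (by positivity) (Real.abs_sin_le_one _)
    have h2 : -(x * u) - t * u ^ M * Real.cos (M * Real.pi) ≤ C + -(x / 2 * u) := by
      have h3 := hC u hu0.le
      have h4 := Real.neg_one_le_cos (M * Real.pi)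
      have h5 : 0 ≤ t * u ^ M := by positivity
      nlinarith
    calc _ ≤ Real.exp (C + -(x / 2 * u)) * (t * u ^ M) := by gcongr
      _ = _ := by rw [Real.exp_add, add_sub_cancel_left]; ring
  have hb := hI.const_mul (t * Real.exp C)
  have hmain : |(∫ u in Set.Ioi (0 : ℝ), rayIntegrand x t 0 M m 0 Real.pi u).im| ≤
      ∫ u in Set.Ioi (0 : ℝ), t * Real.exp C * (u ^ (1 + M - 1) * Real.exp (-(x / 2 * u))) := by
    -- Integrability need not be decided: in the other case the integral is `0` by convention and
    -- the bound is trivial.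
    by_cases hi : IntegrableOn (rayIntegrand x t 0 M m 0 Real.pi) (Set.Ioi 0)
    · have : (∫ u in Set.Ioi (0 : ℝ), rayIntegrand x t 0 M m 0 Real.pi u).im =
          ∫ u in Set.Ioi (0 : ℝ), (rayIntegrand x t 0 M m 0 Real.pi u).im := by
        have := integral_im (𝕜 := ℂ) hi
        simpa using this.symm
      rw [this, ← Real.norm_eq_abs]
      refine norm_integral_le_of_norm_le hb ?_
      exact (ae_restrict_iff' measurableSet_Ioi).2 (.of_forall hle)
    · rw [integral_undef hi]
      simp only [Complex.zero_im, abs_zero]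
      exact setIntegral_nonneg measurableSet_Ioi fun u hu => (abs_nonneg _).trans (hle u hu)
  rw [him]
  refine hmain.trans (le_of_eq ?_)
  rw [integral_const_mul, Real.integral_rpow_mul_exp_neg_mul_Ioi (by linarith) (by linarith)]
  have : (1 / (x / 2)) ^ (1 + M) = 2 ^ (1 + M) * x ^ (-1 - M) := by
    rw [one_div_div, Real.div_rpow two_pos.le hx0.le, show -1 - M = -(1 + M) by ring,
      Real.rpow_neg hx0.le, div_eq_mul_inv]
  rw [this]
  ring

variable {t' m : ℝ}

/-- The (real) inverse Fourier transform of `twoScaleCharFun`. -/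
noncomputable def invCharFun (t t' M m x : ℝ) : ℝ :=
  -(1 / Real.pi) * (rayIntegral x t t' M m 0 (Real.pi / 2)).im

theorem fourier_twoScaleCharFun (ht : 0 < t) (ht' : 0 ≤ t') (hM0 : 0 < M) (hM1 : M < 1)
    (hm0 : 0 < m) (hm1 : m < 1) :
    𝓕 (fun η : ℝ => twoScaleCharFun t t' M m (2 * Real.pi * η)) =
      fun x => (invCharFun t t' M m x : ℂ) := by
  funext x
  rw [fourier_comp_two_pi_mul, integral_exp_mul_twoScaleCharFun ht ht' hM0 hM1 hm0 hm1,
    invCharFun]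

theorem integrable_twoScaleCharFun_comp (ht : 0 < t) (ht' : 0 ≤ t') (hM0 : 0 < M) (hM1 : M < 1)
    (hm0 : 0 < m) (hm1 : m < 1) :
    Integrable fun η : ℝ => twoScaleCharFun t t' M m (2 * Real.pi * η) :=
  (integrable_twoScaleCharFun ht ht' hM0 hM1 hm0 hm1).comp_mul_left' (by positivity)

theorem continuous_invCharFun (ht : 0 < t) (ht' : 0 ≤ t') (hM0 : 0 < M) (hM1 : M < 1)
    (hm0 : 0 < m) (hm1 : m < 1) : Continuous fun x => (invCharFun t t' M m x : ℂ) := by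
  rw [← fourier_twoScaleCharFun ht ht' hM0 hM1 hm0 hm1]
  exact VectorFourier.fourierIntegral_continuous Real.continuous_fourierChar
    (by exact continuous_inner) (integrable_twoScaleCharFun_comp ht ht' hM0 hM1 hm0 hm1)

theorem invCharFun_of_neg (ht : 0 < t) (ht' : 0 ≤ t') (hM0 : 0 < M) (hM1 : M < 1)
    (hm0 : 0 < m) (hm1 : m < 1) {x : ℝ} (hx : x < 0) : invCharFun t t' M m x = 0 := by
  rw [invCharFun, rayIntegral_pi_div_two_im_of_neg ht ht' hM0 hM1 hm0 hm1 le_rfl hx, mul_zero]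

/-- Zero on the left, continuous in the middle, `O(x^{-1-M})` on the right. This supplies the
integrability that Fourier inversion asks for. -/
theorem integrable_invCharFun (ht : 0 < t) (hM0 : 0 < M) (hM1 : M < 1)
    (hm0 : 0 < m) (hm1 : m < 1) : Integrable fun x => (invCharFun t 0 M m x : ℂ) := by
  have hcont := continuous_invCharFun ht le_rfl hM0 hM1 hm0 hm1
  have h1 : IntegrableOn (fun x => (invCharFun t 0 M m x : ℂ)) (Set.Iio 0) :=
    (integrableOn_zero).congr_fun (fun x hx => by
      rw [invCharFun_of_neg ht le_rfl hM0 hM1 hm0 hm1 hx, Complex.ofReal_zero]) measurableSet_Iio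
  have h2 : IntegrableOn (fun x => (invCharFun t 0 M m x : ℂ)) (Set.Icc 0 1) :=
    hcont.continuousOn.integrableOn_Icc
  have h3 : IntegrableOn (fun x => (invCharFun t 0 M m x : ℂ)) (Set.Ioi 1) := by
    obtain ⟨C, hC⟩ := rayIntegral_pi_im_bound ht hM0 hM1 m
    have hi := (integrableOn_Ioi_rpow_of_lt (show -1 - M < -1 by linarith) one_pos).const_mul
      (1 / Real.pi * C)
    refine hi.mono' hcont.aestronglyMeasurable
      ((ae_restrict_iff' measurableSet_Ioi).2 (.of_forall fun x hx => ?_))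
    have hx1 : (1 : ℝ) < x := hx
    have hpi := Real.pi_pos
    rw [Complex.norm_real, invCharFun, rayIntegral_eq_pi ht le_rfl hM0 hM1 hm0 hm1 le_rfl
      (by linarith) ⟨le_rfl, by linarith⟩, norm_mul, norm_neg, Real.norm_of_nonneg (by positivity),
      mul_assoc]
    gcongr
    exact hC x hx1.le
  rw [← integrableOn_univ]
  refine ((h1.union h2).union h3).mono_set fun x _ => ?_
  rcases lt_or_ge x 0 with h | h
  · exact Or.inl (Or.inl h)
  · rcases le_or_gt x 1 with h' | h'
    · exact Or.inl (Or.inr ⟨h, h'⟩)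
    · exact Or.inr h'

theorem oneSidedDensity_eq (ht : 0 < t) (hM0 : 0 < M) (hM1 : M < 1) (hm0 : 0 < m) (hm1 : m < 1)
    (x : ℝ) : oneSidedDensity M t x = invCharFun t 0 M m x := by
  have h := integral_exp_mul_twoScaleCharFun ht le_rfl hM0 hM1 hm0 hm1 x
  have e : twoScaleCharFun t 0 M m = fun ω => stableCharFun M (-M) 1 t ω := by
    funext ω
    simp [twoScaleCharFun, stableCharFun]
  rw [e] at h
  rw [oneSidedDensity, stableDensity, h, Complex.ofReal_re, invCharFun]

/-- The convolution theorem over the whole line; since both densities vanish on the negative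
half-line, only `0 < y ≤ x` contributes. -/
theorem twoScaleDensity_eq_invCharFun (ht : 0 < t) (hM0 : 0 < M) (hM1 : M < 1)
    (hm0 : 0 < m) (hm1 : m < 1) {x : ℝ} (hx : 0 < x) :
    twoScaleDensity M m t x = invCharFun t t M m x := by
  have hM := fourier_twoScaleCharFun ht le_rfl hM0 hM1 hm0 hm1
  have hm := fourier_twoScaleCharFun ht le_rfl hm0 hm1 hM0 hM1
  have hMm := fourier_twoScaleCharFun ht ht.le hM0 hM1 hm0 hm1
  have hcont : Continuous fun η : ℝ => twoScaleCharFun t 0 M m (2 * Real.pi * η) :=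
    (continuous_twoScaleCharFun hM0 hm0).comp (by fun_prop)
  have h := integral_fourier_mul_fourier_sub hcont
    (integrable_twoScaleCharFun_comp ht le_rfl hM0 hM1 hm0 hm1)
    (integrable_twoScaleCharFun_comp ht le_rfl hm0 hm1 hM0 hM1)
    (by rw [hM]; exact integrable_invCharFun ht hM0 hM1 hm0 hm1) x
  have hprod : (fun v : ℝ => twoScaleCharFun t 0 M m (2 * Real.pi * v) *
      twoScaleCharFun t 0 m M (2 * Real.pi * v)) =
      fun v => twoScaleCharFun t t M m (2 * Real.pi * v) := by
    funext v
    simp [twoScaleCharFun, stableCharFun]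
  rw [hprod, hM, hm, hMm] at h
  simp only [← Complex.ofReal_mul] at h
  rw [integral_complex_ofReal, Complex.ofReal_inj] at h
  rw [← h, twoScaleDensity, intervalIntegral.integral_of_le hx.le]
  -- Vanishing is known only for strictly negative arguments, so the point `y = 0` outside `(0, x]`
  -- is discarded as a null set.
  have h0 : ∀ᵐ y : ℝ, y ≠ 0 := by simp [ae_iff]
  have hsupp : ∀ᵐ y : ℝ, y ∉ Set.Ioc 0 x →
      invCharFun t 0 M m y * invCharFun t 0 m M (x - y) = 0 := by
    filter_upwards [h0] with y hy0 hy
    rcases lt_or_gt_of_ne hy0 with h' | h'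
    · rw [invCharFun_of_neg ht le_rfl hM0 hM1 hm0 hm1 h', zero_mul]
    · have : x - y < 0 := by
        by_contra hc
        exact hy ⟨h', by linarith⟩
      rw [invCharFun_of_neg ht le_rfl hm0 hm1 hM0 hM1 this, mul_zero]
  rw [← setIntegral_eq_integral_of_ae_compl_eq_zero hsupp]
  refine setIntegral_congr_fun measurableSet_Ioc fun y _ => ?_
  rw [oneSidedDensity_eq ht hM0 hM1 hm0 hm1, oneSidedDensity_eq ht hm0 hm1 hM0 hM1]

theorem invCharFun_comm (t t' M m x : ℝ) : invCharFun t t' M m x = invCharFun t' t m M x := by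
  simp only [invCharFun, rayIntegral, logIntegrand]
  congr 3
  funext v
  congr 1
  ring

theorem twoScaleDensity_eq_max_min {a b : ℝ} (ht : 0 < t) (ha0 : 0 < a) (ha1 : a < 1)
    (hb0 : 0 < b) (hb1 : b < 1) {x : ℝ} (hx : 0 < x) :
    twoScaleDensity a b t x =
      -(1 / Real.pi) * (rayIntegral x t t (max a b) (min a b) 0 Real.pi).im := by
  have hpi := Real.pi_pos
  have h : twoScaleDensity a b t x = invCharFun t t (max a b) (min a b) x := by
    rw [twoScaleDensity_eq_invCharFun ht ha0 ha1 hb0 hb1 hx]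
    rcases le_total a b with hab | hab
    · rw [max_eq_right hab, min_eq_left hab, invCharFun_comm]
    · rw [max_eq_left hab, min_eq_right hab]
  rw [h, invCharFun, rayIntegral_eq_pi ht ht.le (lt_max_of_lt_left ha0) (max_lt ha1 hb1)
    (lt_min ha0 hb0) (min_lt_of_left_lt ha1) le_rfl hx ⟨le_rfl, by linarith⟩]

end

/-! ### Termwise Laplace transform and the double power series -/

section laplace

variable {ι : Type*} [Countable ι] {c : ι → ℂ} {e : ι → ℝ} {x : ℝ} {G : ℝ → ℂ} {B : ℝ → ℝ}

theorem integrableOn_rpow_mul_exp_neg_mul {a r : ℝ} (ha : 0 ≤ a) (hr : 0 < r) :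
    IntegrableOn (fun u : ℝ => u ^ a * Real.exp (-(r * u))) (Set.Ioi 0) := by
  have := integrableOn_rpow_mul_exp_neg_mul_rpow (p := 1) (s := a) (b := r)
    (by linarith) one_pos hr
  simpa using this

theorem integral_rpow_mul_exp_neg_mul {a r : ℝ} (ha : 0 ≤ a) (hr : 0 < r) :
    ∫ u in Set.Ioi (0 : ℝ), u ^ a * Real.exp (-(r * u)) = Real.Gamma (1 + a) / r ^ (1 + a) := by
  have := Real.integral_rpow_mul_exp_neg_mul_Ioi (a := 1 + a) (by linarith) hr
  rw [add_sub_cancel_left] at this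
  rw [this, one_div, Real.inv_rpow hr.le, div_eq_mul_inv, mul_comm]

/-- Termwise Laplace transform of a generalized power series `∑ c_i u^{e_i}`. -/
theorem hasSum_laplace (hx : 0 < x) (he : ∀ i, 0 ≤ e i)
    (hG : ∀ u, 0 < u → HasSum (fun i => c i * (u ^ e i : ℝ)) (G u))
    (hB : ∀ u, 0 < u → ∀ s : Finset ι, ∑ i ∈ s, ‖c i‖ * u ^ e i ≤ B u)
    (hBi : IntegrableOn (fun u => Real.exp (-(x * u)) * B u) (Set.Ioi 0)) :
    Summable (fun i => ‖c i‖ * (Real.Gamma (1 + e i) / x ^ (1 + e i))) ∧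
      HasSum (fun i => c i * (Real.Gamma (1 + e i) / x ^ (1 + e i) : ℝ))
        (∫ u in Set.Ioi (0 : ℝ), Real.exp (-(x * u)) * G u) := by
  set F : ι → ℝ → ℂ := fun i u => c i * ((u ^ e i * Real.exp (-(x * u)) : ℝ) : ℂ) with hF
  have hI := fun i => integrableOn_rpow_mul_exp_neg_mul (he i) hx
  have hFi : ∀ i, Integrable (F i) (volume.restrict (Set.Ioi 0)) := fun i =>
    ((hI i).ofReal (𝕜 := ℂ)).const_mul (c i)
  have hFint : ∀ i, ∫ u in Set.Ioi (0 : ℝ), F i u =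
      c i * (Real.Gamma (1 + e i) / x ^ (1 + e i) : ℝ) := fun i => by
    rw [hF, integral_const_mul, integral_complex_ofReal, integral_rpow_mul_exp_neg_mul (he i) hx]
  have hFn : ∀ i, ∫ u in Set.Ioi (0 : ℝ), ‖F i u‖ =
      ‖c i‖ * (Real.Gamma (1 + e i) / x ^ (1 + e i)) := fun i => by
    rw [← integral_rpow_mul_exp_neg_mul (he i) hx, ← integral_const_mul]
    refine setIntegral_congr_fun measurableSet_Ioi fun u hu => ?_
    have hu0 : 0 < u := hu
    simp only [hF]
    rw [norm_mul, Complex.norm_real, Real.norm_of_nonneg (by positivity)]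
  -- Partial sums of the norm integrals are bounded by `∫ e^{-xu} B(u) du`, which justifies summing
  -- termwise.
  have hsum : Summable fun i => ∫ u in Set.Ioi (0 : ℝ), ‖F i u‖ := by
    refine summable_of_sum_le (fun i => integral_nonneg fun u => norm_nonneg _)
      (c := ∫ u in Set.Ioi (0 : ℝ), Real.exp (-(x * u)) * B u) fun s => ?_
    rw [← integral_finsetSum _ fun i _ => (hFi i).norm]
    refine setIntegral_mono_on (integrable_finsetSum _ fun i _ => (hFi i).norm) hBi
      measurableSet_Ioi fun u hu => ?_
    have hu0 : 0 < u := hu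
    have := mul_le_mul_of_nonneg_left (hB u hu0 s) (Real.exp_pos (-(x * u))).le
    refine le_trans (le_of_eq ?_) this
    rw [Finset.mul_sum]
    refine Finset.sum_congr rfl fun i _ => ?_
    simp only [hF]
    rw [norm_mul, Complex.norm_real, Real.norm_of_nonneg (by positivity)]
    ring
  refine ⟨by simpa only [hFn] using hsum, ?_⟩
  have h := hasSum_integral_of_summable_integral_norm hFi hsum
  simp only [hFint] at h
  convert! h using 1
  refine setIntegral_congr_fun measurableSet_Ioi fun u hu => ?_
  have h1 := (hG u hu).mul_left (Real.exp (-(x * u)) : ℂ)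
  rw [← h1.tsum_eq]
  refine tsum_congr fun i => ?_
  simp only [hF]
  push_cast
  ring

end laplace

theorem integrableOn_exp_neg_mul_rpow_exp {x t t' M m ρ : ℝ} (hx : 0 < x) (ht : 0 ≤ t)
    (ht' : 0 ≤ t') (hM0 : 0 < M) (hM1 : M < 1) (hm0 : 0 < m) (hm1 : m < 1) (hρ : 0 ≤ ρ) :
    IntegrableOn (fun u : ℝ => Real.exp (-(x * u)) *
      (u ^ ρ * (Real.exp (t * u ^ M) * Real.exp (t' * u ^ m)))) (Set.Ioi 0) := by
  -- Each power costs a quarter of the exponential rate, so `e^{-xu/2}` remains.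
  obtain ⟨C₁, h₁⟩ := exists_mul_rpow_le hM1 hM0 (A := x / 4) (by linarith) ht
  obtain ⟨C₂, h₂⟩ := exists_mul_rpow_le hm1 hm0 (A := x / 4) (by linarith) ht'
  have hi := (integrableOn_rpow_mul_exp_neg_mul (r := x / 2) hρ (by linarith)).const_mul
    (Real.exp (C₁ + C₂))
  refine hi.mono' (Measurable.aestronglyMeasurable (by fun_prop))
    ((ae_restrict_iff' measurableSet_Ioi).2 (.of_forall fun u hu => ?_))
  have hu0 : 0 < u := hu
  rw [Real.norm_of_nonneg (by positivity)]
  have e1 : Real.exp (-(x * u)) * (u ^ ρ * (Real.exp (t * u ^ M) * Real.exp (t' * u ^ m))) =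
      u ^ ρ * Real.exp (-(x * u) + (t * u ^ M + t' * u ^ m)) := by
    rw [Real.exp_add, Real.exp_add]; ring
  have e2 : Real.exp (C₁ + C₂) * (u ^ ρ * Real.exp (-(x / 2 * u))) =
      u ^ ρ * Real.exp (C₁ + C₂ + -(x / 2 * u)) := by
    rw [Real.exp_add (C₁ + C₂)]; ring
  rw [e1, e2]
  have := h₁ u hu0.le
  have := h₂ u hu0.le
  exact mul_le_mul_of_nonneg_left (Real.exp_le_exp.2 (by linarith)) (by positivity)

theorem hasSum_complex_exp (z : ℂ) : HasSum (fun n : ℕ => z ^ n / (n.factorial : ℂ))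
    (Complex.exp z) := by
  rw [Complex.exp_eq_exp_ℂ]
  exact NormedSpace.expSeries_div_hasSum_exp z

theorem HasSum.mul_prod_of_rclike {𝕜 : Type*} [RCLike 𝕜] {f g : ℕ → 𝕜} {a b : 𝕜}
    (hf : HasSum f a) (hg : HasSum g b) :
    HasSum (fun i : ℕ × ℕ => f i.1 * g i.2) (a * b) :=
  hf.mul hg (summable_mul_of_summable_norm hf.summable.norm hg.summable.norm)

section

variable {x t t' M m ρ : ℝ}

/-- The double power series of the ray integral along the negative half-line. -/
theorem hasSum_rayIntegral_pi (hx : 0 < x) (ht : 0 ≤ t) (ht' : 0 ≤ t') (hM0 : 0 < M)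
    (hM1 : M < 1) (hm0 : 0 < m) (hm1 : m < 1) (hρ : 0 ≤ ρ) :
    Summable (fun i : ℕ × ℕ => t ^ i.1 * t' ^ i.2 / ((i.1.factorial : ℝ) * i.2.factorial) *
      (Real.Gamma (1 + (ρ + M * i.1 + m * i.2)) / x ^ (1 + (ρ + M * i.1 + m * i.2)))) ∧
    HasSum (fun i : ℕ × ℕ => -(1 / Real.pi) *
      ((-t) ^ i.1 * (-t') ^ i.2 / ((i.1.factorial : ℝ) * i.2.factorial) *
      (Real.Gamma (1 + (ρ + M * i.1 + m * i.2)) / x ^ (1 + (ρ + M * i.1 + m * i.2))) *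
        Real.sin (Real.pi * (ρ + M * i.1 + m * i.2))))
      (-(1 / Real.pi) * (rayIntegral x t t' M m ρ Real.pi).im) := by
  -- On the ray `s = u e^{-iπ}` one has `s^M = u^M a(M)`.
  set a : ℝ → ℂ := fun M => Complex.exp (-(Complex.I * (M * Real.pi))) with ha
  have han : ∀ M, ‖a M‖ = 1 := fun M => by
    have : -(Complex.I * (M * Real.pi)) = ((-(M * Real.pi) : ℝ) : ℂ) * Complex.I := by
      push_cast; ring
    rw [ha]; simp only; rw [this, Complex.norm_exp_ofReal_mul_I]
  have hone : ∀ (t M u : ℝ), 0 < u → HasSum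
      (fun n : ℕ => ((-t : ℝ) * a M) ^ n / (n.factorial : ℂ) * ((u ^ (M * n) : ℝ) : ℂ))
      (Complex.exp (-(t * (u ^ M : ℝ) * a M))) := by
    intro t M u hu
    refine (hasSum_complex_exp (-(t * (u ^ M : ℝ) * a M))).congr_fun fun n => ?_
    rw [Real.rpow_mul hu.le, Real.rpow_natCast,
      show -(t * (u ^ M : ℝ) * a M) = ((-t : ℝ) * a M) * ((u ^ M : ℝ) : ℂ) by push_cast; ring,
      mul_pow _ ((u ^ M : ℝ) : ℂ)]
    push_cast
    ring
  have honeB : ∀ (t M u : ℝ), 0 ≤ t → 0 < u → HasSum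
      (fun n : ℕ => t ^ n / (n.factorial : ℝ) * u ^ (M * n)) (Real.exp (t * u ^ M)) := by
    intro t M u ht hu
    have := NormedSpace.expSeries_div_hasSum_exp (t * u ^ M)
    rw [← Real.exp_eq_exp_ℝ] at this
    refine this.congr_fun fun n => ?_
    rw [Real.rpow_mul hu.le, Real.rpow_natCast, mul_pow]
    ring
  set c : ℕ × ℕ → ℂ := fun i => ((-t : ℝ) * a M) ^ i.1 / (i.1.factorial : ℂ) *
    (((-t' : ℝ) * a m) ^ i.2 / (i.2.factorial : ℂ)) with hc
  have hcn : ∀ i, ‖c i‖ = t ^ i.1 * t' ^ i.2 / ((i.1.factorial : ℝ) * i.2.factorial) := by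
    intro i
    simp only [hc, norm_mul, norm_div, norm_pow, han, Complex.norm_real, norm_neg,
      Real.norm_of_nonneg ht, Real.norm_of_nonneg ht', Complex.norm_natCast, mul_one]
    field_simp
  set e : ℕ × ℕ → ℝ := fun i => ρ + M * i.1 + m * i.2 with he
  have hpow : ∀ u : ℝ, 0 < u → ∀ i : ℕ × ℕ, u ^ e i = u ^ ρ * (u ^ (M * i.1) * u ^ (m * i.2)) := by
    intro u hu i
    rw [he, Real.rpow_add hu, Real.rpow_add hu, mul_assoc]
  set G : ℝ → ℂ := fun u => (u ^ ρ : ℝ) * (Complex.exp (-(t * (u ^ M : ℝ) * a M)) *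
    Complex.exp (-(t' * (u ^ m : ℝ) * a m))) with hGdef
  have hG : ∀ u, 0 < u → HasSum (fun i => c i * (u ^ e i : ℝ)) (G u) := by
    intro u hu
    have h := HasSum.mul_prod_of_rclike (hone t M u hu) (hone t' m u hu)
    refine (h.mul_left ((u ^ ρ : ℝ) : ℂ)).congr_fun fun i => ?_
    rw [hpow u hu]
    simp only [hc]
    push_cast
    ring
  have hB : ∀ u, 0 < u → ∀ s : Finset (ℕ × ℕ), ∑ i ∈ s, ‖c i‖ * u ^ e i ≤
      u ^ ρ * (Real.exp (t * u ^ M) * Real.exp (t' * u ^ m)) := by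
    intro u hu s
    have h := HasSum.mul_prod_of_rclike (honeB t M u ht hu) (honeB t' m u ht' hu)
    refine le_trans (le_of_eq ?_)
      (sum_le_hasSum s (fun i _ => by positivity) (h.mul_left (u ^ ρ)))
    refine Finset.sum_congr rfl fun i _ => ?_
    rw [hpow u hu, hcn]
    field_simp
  have he0 : ∀ i, 0 ≤ e i := fun i => by simp only [he]; positivity
  obtain ⟨h1, h2⟩ := hasSum_laplace hx he0 hG hB
    (integrableOn_exp_neg_mul_rpow_exp hx ht ht' hM0 hM1 hm0 hm1 hρ)
  refine ⟨by simpa only [hcn] using h1, ?_⟩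
  have hray : rayIntegral x t t' M m ρ Real.pi =
      Complex.exp (-(Complex.I * Real.pi * (1 + ρ))) *
        ∫ u in Set.Ioi (0 : ℝ), (Real.exp (-(x * u)) : ℂ) *
        ((u ^ ρ : ℝ) * (Complex.exp (-(t * (u ^ M : ℝ) * a M)) *
          Complex.exp (-(t' * (u ^ m : ℝ) * a m)))) := by
    rw [rayIntegral_eq_integral_Ioi, ← integral_const_mul]
    refine integral_congr_ae (.of_forall fun u => ?_)
    have hpiI : Complex.exp (-(Complex.I * (Real.pi : ℂ))) = -1 := by
      rw [Complex.exp_neg, mul_comm, Complex.exp_pi_mul_I]; norm_num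
    simp only [rayIntegrand, hpiI]
    rw [sub_eq_add_neg, sub_eq_add_neg, Complex.exp_add, Complex.exp_add]
    push_cast
    simp only [mul_neg_one]
    ring
  have h3 := h2.mul_left (Complex.exp (-(Complex.I * Real.pi * (1 + ρ))))
  rw [← hray] at h3
  refine ((Complex.hasSum_im h3).mul_left (-(1 / Real.pi))).congr_fun fun i => ?_
  congr 1
  -- All phases combine to `e^{-iπ(e_i + 1)}`, whose imaginary part is `sin (π e_i)`.
  have e1 : Complex.exp (-(Complex.I * Real.pi * (1 + ρ))) * c i =
      (((-t) ^ i.1 * (-t') ^ i.2 / ((i.1.factorial : ℝ) * i.2.factorial) : ℝ) : ℂ) *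
        Complex.exp ((-(Real.pi * e i + Real.pi) : ℝ) * Complex.I) := by
    have e2 : Complex.exp ((-(Real.pi * e i + Real.pi) : ℝ) * Complex.I) =
        Complex.exp (-(Complex.I * Real.pi * (1 + ρ))) * (a M ^ i.1 * a m ^ i.2) := by
      simp only [ha, ← Complex.exp_nat_mul, ← Complex.exp_add, he]
      congr 1
      push_cast
      ring
    rw [e2]
    simp only [hc, mul_pow]
    push_cast
    field_simp
  rw [← mul_assoc (Complex.exp _), e1, Complex.im_mul_ofReal, Complex.im_ofReal_mul,
    Complex.exp_ofReal_mul_I_im, Real.sin_neg, Real.sin_add_pi, neg_neg]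
  simp only [he]
  ring

end

/-! ### Collecting residue classes into hypergeometric functions -/

theorem Gamma_add_natCast_eq_prod {a : ℝ} (ha : 0 < a) (N : ℕ) :
    Real.Gamma (a + N) = (∏ i ∈ Finset.range N, (a + i)) * Real.Gamma a := by
  induction N with
  | zero => simp
  | succ N ih =>
    rw [Nat.cast_succ, ← add_assoc, Real.Gamma_add_one (by positivity), ih,
      Finset.prod_range_succ]
    ring

theorem ascPochhammer_eval_eq_prod_range_add (a : ℝ) (j : ℕ) :
    (ascPochhammer ℝ j).eval a = ∏ i ∈ Finset.range j, (a + i) := by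
  induction j with
  | zero => simp
  | succ j ih => rw [ascPochhammer_succ_eval, ih, Finset.prod_range_succ]

/-- The finite multiplication formula: `(a)_{Kj}`, divided by `K^{Kj}`, splits over the residues
modulo `K` into Pochhammer symbols of the points of `Δ(K, a)`. -/
theorem prod_ascPochhammer_unifPart {K : ℕ} (hK : 0 < K) {a : ℝ} (ha : 0 < a) (j : ℕ) :
    ∏ i, (ascPochhammer ℝ j).eval (unifPart K a i) =
      Real.Gamma (a + (K * j : ℕ)) / Real.Gamma a / (K : ℝ) ^ (K * j) := by
  have hK' : (K : ℝ) ≠ 0 := by exact_mod_cast hK.ne'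
  have h := prod_range_prod_range_add_div K hK (a / K) j
  rw [mul_div_cancel₀ _ hK'] at h
  rw [Gamma_add_natCast_eq_prod ha, mul_div_cancel_right₀ _ (Real.Gamma_pos_of_pos ha).ne', ← h,
    Finset.prod_range]
  refine Finset.prod_congr rfl fun i _ => ?_
  rw [ascPochhammer_eval_eq_prod_range_add, unifPart]
  simp only [add_div]

/-- The upper parameter `1` contributes `(1)_j = j!`, which cancels the factorial of the series. -/
theorem hypTerm_cons_one_unifPart {L K : ℕ} (hL : 0 < L) (hK : 0 < K) {a : ℝ} (ha : 0 < a)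
    (n : ℕ) (z : ℝ) (j : ℕ) :
    hypTerm (Fin.cons 1 (unifPart L a) : Fin (L + 1) → ℝ) (unifPart K (1 + n)) z j =
      z ^ j * ((K : ℝ) ^ (K * j) / (L : ℝ) ^ (L * j)) *
        (Real.Gamma (a + (L * j : ℕ)) / Real.Gamma a) *
        ((n.factorial : ℝ) / ((n + K * j).factorial : ℝ)) := by
  rw [hypTerm, Fin.prod_univ_succ]
  simp only [Fin.cons_zero, Fin.cons_succ, ascPochhammer_eval_one]
  rw [prod_ascPochhammer_unifPart hL ha, prod_ascPochhammer_unifPart hK (by positivity)]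
  have e1 : Real.Gamma (1 + n + (K * j : ℕ)) = ((n + K * j).factorial : ℝ) := by
    rw [← Real.Gamma_nat_eq_factorial]; push_cast; ring_nf
  have e2 : Real.Gamma (1 + n) = (n.factorial : ℝ) := by
    rw [← Real.Gamma_nat_eq_factorial]; ring_nf
  rw [e1, e2]
  have hL' : (L : ℝ) ≠ 0 := by exact_mod_cast hL.ne'
  have hK' : (K : ℝ) ≠ 0 := by exact_mod_cast hK.ne'
  have := (Real.Gamma_pos_of_pos ha).ne'
  have := j.factorial_ne_zero
  have := n.factorial_ne_zero
  have := (n + K * j).factorial_ne_zero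
  field_simp

section

variable {L K : ℕ} {M t x κ : ℝ}

/-- Passing from the index `n` to `n + K j` in the double series multiplies the coefficient by
the `j`-th term of the hypergeometric series. -/
theorem coeff_mul_hypTerm (hL : 0 < L) (hK : 0 < K) (hM : M * K = L) (hM0 : 0 ≤ M) (hx : 0 < x)
    (hκ : κ = (L : ℝ) ^ L / (K : ℝ) ^ K * (t ^ K / x ^ L)) {ρ : ℝ} (hρ : 0 ≤ ρ) (s : ℝ)
    (n j : ℕ) :
    t ^ n / (n.factorial : ℝ) * (Real.Gamma (1 + (ρ + M * n)) / x ^ (1 + (ρ + M * n))) *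
      hypTerm (Fin.cons 1 (unifPart L (1 + (ρ + M * n))) : Fin (L + 1) → ℝ)
        (unifPart K (1 + n)) (s * κ) j =
      s ^ j * (t ^ (n + K * j) / ((n + K * j).factorial : ℝ) *
        (Real.Gamma (1 + (ρ + M * (n + K * j : ℕ))) / x ^ (1 + (ρ + M * (n + K * j : ℕ))))) := by
  have ha : 0 < 1 + (ρ + M * n) := by positivity
  rw [hypTerm_cons_one_unifPart hL hK ha]
  have e1 : 1 + (ρ + M * (n + K * j : ℕ)) = 1 + (ρ + M * n) + (L * j : ℕ) := by
    push_cast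
    rw [← hM]
    ring
  rw [e1, Real.rpow_add_natCast hx.ne', hκ]
  have hL' : (L : ℝ) ≠ 0 := by exact_mod_cast hL.ne'
  have hK' : (K : ℝ) ≠ 0 := by exact_mod_cast hK.ne'
  have := (Real.Gamma_pos_of_pos ha).ne'
  have := n.factorial_ne_zero
  have := (n + K * j).factorial_ne_zero
  have hxp : x ^ (1 + (ρ + M * n)) ≠ 0 := (Real.rpow_pos_of_pos hx _).ne'
  generalize Real.Gamma (1 + (ρ + M * n) + (L * j : ℕ)) = g2 at *
  generalize Real.Gamma (1 + (ρ + M * n)) = g1 at *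
  generalize x ^ (1 + (ρ + M * n)) = y at *
  rw [mul_pow, mul_pow, div_pow, div_pow, ← pow_mul, ← pow_mul, ← pow_mul, ← pow_mul, pow_add]
  field_simp

theorem summable_coeff (ht : 0 ≤ t) (hM0 : 0 < M) (hM1 : M < 1) (hx : 0 < x) {ρ : ℝ}
    (hρ : 0 ≤ ρ) :
    Summable fun n : ℕ => t ^ n / (n.factorial : ℝ) *
      (Real.Gamma (1 + (ρ + M * n)) / x ^ (1 + (ρ + M * n))) := by
  have h := (hasSum_rayIntegral_pi (m := M) hx ht le_rfl hM0 hM1 hM0 hM1 hρ).1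
  refine (h.comp_injective (i := fun n : ℕ => (n, 0)) fun a b hab => by simpa using hab).congr
    fun n => ?_
  simp

/-- Up to a nonzero constant and signs, the terms are the coefficients with indices `n + K j` of a
series already known to converge, so no ratio test is needed. -/
theorem summable_hypTerm (ht : 0 < t) (hM0 : 0 < M) (hM1 : M < 1) (hL : 0 < L) (hK : 0 < K)
    (hM : M * K = L) (hx : 0 < x)
    (hκ : κ = (L : ℝ) ^ L / (K : ℝ) ^ K * (t ^ K / x ^ L)) {ρ : ℝ} (hρ : 0 ≤ ρ) {s : ℝ}
    (hs : |s| = 1) (n : ℕ) :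
    Summable (hypTerm (Fin.cons 1 (unifPart L (1 + (ρ + M * n))) : Fin (L + 1) → ℝ)
      (unifPart K (1 + n)) (s * κ)) := by
  have ha : 0 < 1 + (ρ + M * n) := by positivity
  have hG := Real.Gamma_pos_of_pos ha
  have hc : t ^ n / (n.factorial : ℝ) *
      (Real.Gamma (1 + (ρ + M * n)) / x ^ (1 + (ρ + M * n))) ≠ 0 := by positivity
  rw [← summable_mul_left_iff hc]
  have h := (summable_coeff ht.le hM0 hM1 hx hρ).comp_injective (i := fun j : ℕ => n + K * j)
    fun a b hab => by
      have : K * a = K * b := by simpa using hab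
      exact Nat.eq_of_mul_eq_mul_left hK this
  refine Summable.of_norm_bounded h fun j => ?_
  rw [coeff_mul_hypTerm hL hK hM hM0.le hx hκ hρ, norm_mul, norm_pow, Real.norm_eq_abs s, hs,
    one_pow, one_mul, Function.comp_apply, Real.norm_of_nonneg]
  have ha2 : 0 < 1 + (ρ + M * (n + K * j : ℕ)) := by positivity
  have hG2 := Real.Gamma_pos_of_pos ha2
  positivity

theorem tsum_eq_sum_range_tsum {f : ℕ → ℝ} (hf : Summable f) {N : ℕ} (hN : 0 < N) :
    ∑' n, f n = ∑ n ∈ Finset.range N, ∑' j, f (n + N * j) := by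
  obtain ⟨N, rfl⟩ : ∃ d, N = d + 1 := ⟨N - 1, by omega⟩
  rw [Nat.sumByResidueClasses hf (N + 1), Finset.sum_range]
  rfl

/-- The single series, with its terms collected into `K` hypergeometric functions. -/
theorem rayIntegral_eq_sum_hypF (ht : 0 < t) (hM0 : 0 < M) (hM1 : M < 1) (hL : 0 < L) (hK : 0 < K)
    (hM : M * K = L) (hx : 0 < x)
    (hκ : κ = (L : ℝ) ^ L / (K : ℝ) ^ K * (t ^ K / x ^ L)) {ρ m : ℝ} (hρ : 0 ≤ ρ)
    (hm0 : 0 < m) (hm1 : m < 1) :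
    HasSum (fun n : ℕ => -(1 / Real.pi) * ((-t) ^ n / (n.factorial : ℝ) *
      (Real.Gamma (1 + (ρ + M * n)) / x ^ (1 + (ρ + M * n))) *
        Real.sin (Real.pi * (ρ + M * n)))) (-(1 / Real.pi) * (rayIntegral x t 0 M m ρ Real.pi).im) ∧
    -(1 / Real.pi) * (rayIntegral x t 0 M m ρ Real.pi).im =
      -(1 / Real.pi) * ∑ n ∈ Finset.range K, (-t) ^ n / (n.factorial : ℝ) *
        (Real.Gamma (1 + (ρ + M * n)) / x ^ (1 + (ρ + M * n))) * Real.sin (Real.pi * (ρ + M * n)) *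
        hypF (Fin.cons 1 (unifPart L (1 + (ρ + M * n))) : Fin (L + 1) → ℝ)
          (unifPart K (1 + n)) ((-1) ^ ((K : ℤ) - (L : ℤ)) * κ) := by
  have h := (hasSum_rayIntegral_pi hx ht.le le_rfl hM0 hM1 hm0 hm1 hρ).2
  have hinj : Function.Injective fun n : ℕ => (n, 0) := fun a b hab => by simpa using hab
  rw [← hinj.hasSum_iff] at h
  -- With `t' = 0` every term whose second index is positive vanishes, which leaves a single series.
  swap
  · intro i hi
    have : i.2 ≠ 0 := fun h0 => hi ⟨i.1, by rw [← h0]⟩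
    simp [this]
  have h' : HasSum (fun n : ℕ => -(1 / Real.pi) * ((-t) ^ n / (n.factorial : ℝ) *
      (Real.Gamma (1 + (ρ + M * n)) / x ^ (1 + (ρ + M * n))) *
        Real.sin (Real.pi * (ρ + M * n))))
      (-(1 / Real.pi) * (rayIntegral x t 0 M m ρ Real.pi).im) := by
    refine h.congr_fun fun n => ?_
    simp
  refine ⟨h', ?_⟩
  rw [← h'.tsum_eq, tsum_mul_left]
  congr 1
  have hs : Summable fun n : ℕ => (-t) ^ n / (n.factorial : ℝ) *
      (Real.Gamma (1 + (ρ + M * n)) / x ^ (1 + (ρ + M * n))) *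
        Real.sin (Real.pi * (ρ + M * n)) := by
    refine Summable.of_norm_bounded (summable_coeff ht.le hM0 hM1 hx hρ) fun n => ?_
    have hG := Real.Gamma_pos_of_pos (show 0 < 1 + (ρ + M * n) by positivity)
    rw [norm_mul, norm_mul, norm_div, norm_pow, norm_neg, Real.norm_of_nonneg ht.le,
      Real.norm_of_nonneg (Nat.cast_nonneg _), Real.norm_of_nonneg (by positivity :
        0 ≤ Real.Gamma (1 + (ρ + M * n)) / x ^ (1 + (ρ + M * n)))]
    exact mul_le_of_le_one_right (by positivity) (Real.abs_sin_le_one _)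
  rw [tsum_eq_sum_range_tsum hs hK]
  refine Finset.sum_congr rfl fun n _ => ?_
  rw [hypF, ← tsum_mul_left]
  refine tsum_congr fun j => ?_
  have key := coeff_mul_hypTerm (s := (-1) ^ ((K : ℤ) - (L : ℤ))) hL hK hM hM0.le hx hκ hρ n j
  -- The sign of the argument has two sources: `(-1)^{Kj}` from `(-t)^{n+Kj}` and `(-1)^{Lj}` from
  -- shifting the sine by `L j π`.
  have hsgn : ((-1 : ℝ) ^ ((K : ℤ) - (L : ℤ))) ^ j = (-1) ^ (K * j) * (-1) ^ (L * j) := by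
    rw [zpow_sub₀ (by norm_num), zpow_natCast, zpow_natCast, div_pow, ← pow_mul, ← pow_mul,
      div_eq_mul_inv]
    congr 1
    rcases neg_one_pow_eq_or ℝ (L * j) with h | h <;> rw [h] <;> norm_num
  have hsin : Real.sin (Real.pi * (ρ + M * (n + K * j : ℕ))) =
      (-1) ^ (L * j) * Real.sin (Real.pi * (ρ + M * n)) := by
    have : Real.pi * (ρ + M * (n + K * j : ℕ)) =
        Real.pi * (ρ + M * n) + (L * j : ℕ) * Real.pi := by
      push_cast
      rw [← hM]
      ring
    rw [this, Real.sin_add_nat_mul_pi]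
  rw [hsin]
  rw [hsgn] at key
  rw [neg_pow t, neg_pow t, pow_add (-1 : ℝ)]
  linear_combination (-(-1 : ℝ) ^ n * Real.sin (Real.pi * (ρ + M * n))) * key

end

/-! ### Gamma on vertical strips and the decay of `Γ(Ks + b) / Γ(Ls)` -/

theorem integrable_cexp_mul_sub_exp {a r : ℂ} (ha : 0 < a.re) (hr : 0 < r.re) {M : ℝ}
    (hM : 0 < M) :
    Integrable fun v : ℝ => Complex.exp (a * v - r * Complex.exp (M * v)) := by
  refine (integrable_exp_sub_exp (ρ := a.re - 1) (C := 0) (by linarith) hM hr).mono'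
    (Continuous.aestronglyMeasurable (by fun_prop)) (.of_forall fun v => le_of_eq ?_)
  rw [Complex.norm_exp, ← Real.exp_mul]
  congr 1
  have : Complex.exp ((M : ℂ) * v) = ((Real.exp (M * v) : ℝ) : ℂ) := by push_cast; rfl
  rw [this]
  simp only [Complex.sub_re, Complex.mul_re, Complex.ofReal_re, Complex.ofReal_im, mul_zero,
    sub_zero]
  ring_nf

theorem Gamma_eq_integral_exp {a : ℂ} (ha : 0 < a.re) :
    Complex.Gamma a = ∫ v : ℝ, Complex.exp (a * v - Complex.exp v) := by
  rw [Complex.Gamma_eq_integral ha, Complex.GammaIntegral, integral_Ioi_eq_integral_exp]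
  refine integral_congr_ae (.of_forall fun v => ?_)
  simp only
  rw [Complex.cpow_def_of_ne_zero (by exact_mod_cast (Real.exp_pos v).ne'), ← Complex.ofReal_log
    (Real.exp_pos v).le, Real.log_exp]
  push_cast
  rw [← Complex.exp_add, ← Complex.exp_add]
  congr 1
  ring

/-- Euler's integral along a rotated ray. -/
theorem integral_cexp_mul_sub_exp {a r : ℂ} (ha : 0 < a.re) (hr : 0 < r.re) :
    ∫ v : ℝ, Complex.exp (a * v - r * Complex.exp v) =
      Complex.exp (-(a * Complex.log r)) * Complex.Gamma a := by
  set φ := r.arg with hφ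
  have hr0 : r ≠ 0 := by rintro rfl; simp at hr
  have hφ2 : |φ| < Real.pi / 2 := Complex.abs_arg_lt_pi_div_two_iff.2 (Or.inl hr)
  have hcos : 0 < Real.cos φ := Real.cos_pos_of_mem_Ioo (abs_lt.1 hφ2)
  set F : ℂ → ℂ := fun w => Complex.exp (a * w - Complex.exp w) with hF
  have hnorm : ∀ y ∈ Set.uIcc 0 φ, ∀ v : ℝ, ‖F (v + y * Complex.I)‖ ≤
      Real.exp ((1 + (a.re - 1)) * v + (|a.im| * |φ| - Real.cos φ * Real.exp v ^ (1 : ℝ))) := by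
    intro y hy v
    have hy' : |y| ≤ |φ| := by simpa using Set.abs_sub_left_of_mem_uIcc hy
    rw [hF, Complex.norm_exp]
    refine Real.exp_le_exp.2 ?_
    simp only [Complex.sub_re, Complex.mul_re, Complex.add_re, Complex.ofReal_re, Complex.I_re,
      mul_zero, Complex.ofReal_im, Complex.I_im, mul_one, sub_self, add_zero, Complex.add_im,
      Complex.mul_im, zero_add, Complex.exp_re, Real.rpow_one]
    have h1 : Real.cos φ ≤ Real.cos y := by
      rw [← Real.cos_abs φ, ← Real.cos_abs y]
      exact Real.cos_le_cos_of_nonneg_of_le_pi (abs_nonneg _) (by linarith [Real.pi_pos]) hy'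
    have h2 : -(a.im * y) ≤ |a.im| * |φ| :=
      (neg_le_abs _).trans (by rw [abs_mul]; gcongr)
    have h3 := Real.exp_pos v
    nlinarith
  have hstrip := integral_eq_of_strip (F := F) (a := 0) (b := φ)
    (Differentiable.differentiableOn (by fun_prop)) hnorm
    (integrable_exp_sub_exp (by linarith) one_pos hcos)
    (tendsto_exp_sub_exp_atTop one_pos hcos) (tendsto_exp_sub_exp_atBot (by linarith) hcos)
  have h0 : ∫ v : ℝ, F (v + (0 : ℝ) * Complex.I) = Complex.Gamma a := by
    rw [Gamma_eq_integral_exp ha]; simp [hF]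
  -- The vertical shift by `arg r` and the horizontal one by `log |r|` together replace `v` by `v +
  -- log r`.
  have h1 := integral_add_right_eq_self (μ := volume) (fun v : ℝ => F (v + φ * Complex.I))
    (Real.log ‖r‖)
  have h2 : ∀ v : ℝ, F (((v + Real.log ‖r‖ : ℝ) : ℂ) + φ * Complex.I) =
      Complex.exp (a * Complex.log r) * Complex.exp (a * v - r * Complex.exp v) := by
    intro v
    have e : (((v + Real.log ‖r‖ : ℝ) : ℂ) + φ * Complex.I) = v + Complex.log r := by
      rw [Complex.log, hφ]; push_cast; ring
    rw [e, hF, ← Complex.exp_add]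
    simp only
    rw [Complex.exp_add, Complex.exp_log hr0]
    congr 1
    ring
  simp only [h2] at h1
  rw [integral_const_mul, ← hstrip, h0] at h1
  rw [Complex.exp_neg, ← h1, inv_mul_cancel_left₀ (Complex.exp_ne_zero _)]

/-- Euler's integral is rotated by `±θ`, with the sign of `Im a`. The modulus of the integrand
becomes `e^{σv - cos θ e^v}`, `σ = Re a`, while the rotation factor has modulus `e^{θ |Im a|}` and
stands on the side of `Γ(a)`. -/
theorem norm_Gamma_le {θ : ℝ} (hθ0 : 0 ≤ θ) (hθ : θ < Real.pi / 2) {a : ℂ} (ha : 0 < a.re) :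
    ‖Complex.Gamma a‖ ≤ Real.exp (-(θ * |a.im|)) *
      (Real.exp (-(a.re * Real.log (Real.cos θ))) * Real.Gamma a.re) := by
  have hpi := Real.pi_pos
  have hcos : 0 < Real.cos θ := Real.cos_pos_of_mem_Ioo ⟨by linarith, hθ⟩
  have key : ∀ φ : ℝ, |φ| = θ → ‖Complex.Gamma a‖ * Real.exp (φ * a.im) ≤
      Real.exp (-(a.re * Real.log (Real.cos θ))) * Real.Gamma a.re := by
    intro φ hφ
    have hcosφ : Real.cos φ = Real.cos θ := by rw [← hφ, Real.cos_abs]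
    set r : ℂ := Complex.exp (φ * Complex.I) with hr
    have hrre : r.re = Real.cos θ := by rw [hr, Complex.exp_ofReal_mul_I_re, hcosφ]
    have hφ' := abs_le.1 hφ.le
    have hlog : Complex.log r = φ * Complex.I := by
      rw [hr, Complex.log_exp] <;> simp <;> linarith
    have h1 := integral_cexp_mul_sub_exp ha (r := r) (by rw [hrre]; exact hcos)
    have h2 := integral_cexp_mul_sub_exp (a := (a.re : ℂ)) (by simpa using ha)
      (r := ((Real.cos θ : ℝ) : ℂ)) (by rwa [Complex.ofReal_re])
    have h3 : ∫ v : ℝ, Complex.exp ((a.re : ℂ) * v - (Real.cos θ : ℂ) * Complex.exp v) =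
        ((∫ v : ℝ, Real.exp (a.re * v - Real.cos θ * Real.exp v) : ℝ) : ℂ) := by
      rw [← integral_complex_ofReal]
      simp
    rw [h3, ← Complex.ofReal_log hcos.le, Complex.Gamma_ofReal] at h2
    have h4 : ∫ v : ℝ, Real.exp (a.re * v - Real.cos θ * Real.exp v) =
        Real.exp (-(a.re * Real.log (Real.cos θ))) * Real.Gamma a.re := by
      exact_mod_cast h2
    have h5 := norm_integral_le_integral_norm (μ := volume)
      (fun v : ℝ => Complex.exp (a * v - r * Complex.exp v))
    rw [h1, norm_mul] at h5
    have h6 : ‖Complex.exp (-(a * Complex.log r))‖ = Real.exp (φ * a.im) := by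
      rw [hlog, Complex.norm_exp]
      congr 1
      simp [mul_comm]
    have h7 : ∀ v : ℝ, ‖Complex.exp (a * v - r * Complex.exp v)‖ =
        Real.exp (a.re * v - Real.cos θ * Real.exp v) := by
      intro v
      rw [Complex.norm_exp, ← Complex.ofReal_exp, Complex.sub_re, Complex.re_mul_ofReal,
        Complex.re_mul_ofReal, hrre]
    simp only [h7] at h5
    rw [h6, h4] at h5
    rwa [mul_comm]
  have hle : ‖Complex.Gamma a‖ * Real.exp (θ * |a.im|) ≤
      Real.exp (-(a.re * Real.log (Real.cos θ))) * Real.Gamma a.re := by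
    rcases le_total 0 a.im with h | h
    · rw [abs_of_nonneg h]; exact key θ (abs_of_nonneg hθ0)
    · rw [abs_of_nonpos h, mul_neg, ← neg_mul]
      exact key (-θ) (by rw [abs_neg, abs_of_nonneg hθ0])
  rw [Real.exp_neg, ← div_eq_inv_mul, le_div_iff₀ (Real.exp_pos _)]
  exact hle

/-- Exponential decay of `Γ` on a vertical strip in the right half-plane. -/
theorem exists_norm_Gamma_le {θ : ℝ} (hθ0 : 0 ≤ θ) (hθ : θ < Real.pi / 2) {a b : ℝ} (ha : 0 < a) :
    ∃ C : ℝ, 0 ≤ C ∧ ∀ z : ℂ, z.re ∈ Set.Icc a b →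
      ‖Complex.Gamma z‖ ≤ C * Real.exp (-(θ * |z.im|)) := by
  have hcont : ContinuousOn (fun σ : ℝ =>
      Real.exp (-(σ * Real.log (Real.cos θ))) * Real.Gamma σ) (Set.Icc a b) := by
    refine ContinuousOn.mul (by fun_prop) fun σ hσ => ?_
    have hσ0 : 0 < σ := ha.trans_le hσ.1
    exact (Real.differentiableAt_Gamma fun n => by linarith [n.cast_nonneg (α := ℝ)]).continuousAt.continuousWithinAt
  obtain ⟨C, hC⟩ := isCompact_Icc.exists_bound_of_continuousOn hcont
  refine ⟨|C|, abs_nonneg _, fun z hz => ?_⟩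
  refine (norm_Gamma_le hθ0 hθ (ha.trans_le hz.1)).trans ?_
  rw [mul_comm]
  gcongr
  exact (le_abs_self _).trans ((hC _ hz).trans (le_abs_self C))

/-- Growth of `1 / Γ` on a vertical strip. -/
theorem exists_norm_inv_Gamma_le {θ : ℝ} (hθ0 : 0 ≤ θ) (hθ : θ < Real.pi / 2) (a b : ℝ) :
    ∃ C : ℝ, 0 ≤ C ∧ ∀ z : ℂ, z.re ∈ Set.Icc a b → 1 ≤ |z.im| →
      ‖(Complex.Gamma z)⁻¹‖ ≤ C * Real.exp ((Real.pi - θ) * |z.im|) := by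
  have hpi := Real.pi_pos
  -- Shifting by `N ≥ b` puts `1 - w = 1 - z + N` into `Re ≥ 1`, where the upper bound for Gamma
  -- applies; reflection then controls `1/Γ(w)`. Passing from `w` back to `z` only enlarges `|Γ|`,
  -- because `|Im z| ≥ 1` makes each factor `w + n` at least one in modulus.
  obtain ⟨N, hN⟩ := exists_nat_ge b
  obtain ⟨C, hC0, hC⟩ := exists_norm_Gamma_le hθ0 hθ (a := 1) (b := 1 + N - a) one_pos
  refine ⟨C / Real.pi, by positivity, fun z hz him => ?_⟩
  set w : ℂ := z - N with hw
  have hwim : w.im = z.im := by simp [hw]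
  have hprod : ∀ n : ℕ, ‖Complex.Gamma w‖ ≤ ‖Complex.Gamma (w + n)‖ := by
    intro n
    induction n with
    | zero => simp
    | succ n ih =>
      have him' : (w + n).im = z.im := by simp [hwim]
      have hne : w + n ≠ 0 := by
        intro h
        rw [h] at him'
        rw [← him'] at him
        norm_num at him
      rw [Nat.cast_succ, ← add_assoc, Complex.Gamma_add_one _ hne, norm_mul]
      refine ih.trans (le_mul_of_one_le_left (norm_nonneg _) ?_)
      exact (him.trans_eq (by rw [him'])).trans (Complex.abs_im_le_norm _)
  have hz' : ‖Complex.Gamma w‖ ≤ ‖Complex.Gamma z‖ := by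
    have := hprod N
    rwa [hw, sub_add_cancel] at this
  have hrefl := Complex.Gamma_mul_Gamma_one_sub w
  have hwne : Complex.Gamma w ≠ 0 := by
    refine Complex.Gamma_ne_zero fun n h => ?_
    have := congrArg Complex.im h
    rw [hwim] at this
    simp at this
    rw [this] at him
    norm_num at him
  have hinv : (Complex.Gamma w)⁻¹ = Complex.Gamma (1 - w) * Complex.sin (Real.pi * w) / Real.pi := by
    have hne := Complex.Gamma_ne_zero (s := 1 - w) fun n h => by
      have := congrArg Complex.im h
      simp [hwim] at this
      rw [this] at him
      norm_num at him
    have hs : Complex.sin (Real.pi * w) ≠ 0 := by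
      intro h
      rw [h, div_zero] at hrefl
      exact mul_ne_zero hwne hne hrefl
    have hp : (Real.pi : ℂ) ≠ 0 := by exact_mod_cast hpi.ne'
    rw [eq_div_iff hs] at hrefl
    rw [eq_div_iff hp, inv_mul_eq_iff_eq_mul₀ hwne, ← mul_assoc, hrefl]
  have hsin : ‖Complex.sin (Real.pi * w)‖ ≤ Real.exp (Real.pi * |z.im|) := by
    have e1 : ∀ s : ℝ, |s| = 1 →
        ‖Complex.exp (s * (Real.pi * w) * Complex.I)‖ ≤ Real.exp (Real.pi * |z.im|) := by
      intro s hs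
      rw [Complex.norm_exp]
      refine Real.exp_le_exp.2 ?_
      have : ((s : ℂ) * (Real.pi * w) * Complex.I).re = -(s * (Real.pi * z.im)) := by
        simp [hwim]
      rw [this]
      refine (neg_le_abs _).trans ?_
      rw [abs_mul, abs_mul, hs, one_mul, abs_of_pos hpi]
    have h1 := e1 1 (by simp)
    have h2 := e1 (-1) (by simp)
    have hsd : Complex.sin (Real.pi * w) = (Complex.exp (((-1 : ℝ) : ℂ) * (Real.pi * w) * Complex.I) -
        Complex.exp (((1 : ℝ) : ℂ) * (Real.pi * w) * Complex.I)) * Complex.I / 2 := by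
      rw [Complex.sin]; push_cast; ring_nf
    rw [hsd, norm_div, norm_mul, Complex.norm_I, mul_one, Complex.norm_ofNat,
      div_le_iff₀ two_pos]
    refine (norm_sub_le _ _).trans ?_
    linarith
  have hG := hC (1 - w) ⟨by simp [hw]; linarith [hz.2], by simp [hw]; linarith [hz.1]⟩
  have him1 : |(1 - w).im| = |z.im| := by simp [hwim]
  rw [him1] at hG
  have hwpos : 0 < ‖Complex.Gamma w‖ := norm_pos_iff.2 hwne
  calc ‖(Complex.Gamma z)⁻¹‖ ≤ ‖(Complex.Gamma w)⁻¹‖ := by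
        rw [norm_inv, norm_inv]; gcongr
    _ ≤ (C * Real.exp (-(θ * |z.im|))) * Real.exp (Real.pi * |z.im|) / Real.pi := by
        rw [hinv, norm_div, norm_mul, Complex.norm_real, Real.norm_of_nonneg hpi.le]
        gcongr
    _ = C / Real.pi * Real.exp ((Real.pi - θ) * |z.im|) := by
        rw [mul_assoc, ← Real.exp_add]
        have : -(θ * |z.im|) + Real.pi * |z.im| = (Real.pi - θ) * |z.im| := by ring
        rw [this]; ring

theorem natCast_mul_re (n : ℕ) (s : ℂ) : ((n : ℂ) * s).re = n * s.re := by simp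

theorem natCast_mul_im (n : ℕ) (s : ℂ) : ((n : ℂ) * s).im = n * s.im := by simp

/-- The quotient `Γ(K s + b) / Γ(L s)`. -/
noncomputable def gammaRatio (K L : ℕ) (b : ℝ) (s : ℂ) : ℂ :=
  Complex.Gamma (K * s + b) * (Complex.Gamma (L * s))⁻¹

section

variable {K L : ℕ} {b : ℝ}

theorem differentiableAt_gammaRatio {s : ℂ} (hs : 0 < K * s.re + b) :
    DifferentiableAt ℂ (gammaRatio K L b) s := by
  have h1 : DifferentiableAt ℂ Complex.Gamma (K * s + b) := by
    refine Complex.differentiableAt_Gamma _ fun n h => ?_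
    have := congrArg Complex.re h
    simp at this
    have hn : (0 : ℝ) ≤ n := n.cast_nonneg
    linarith
  have h2 := Complex.differentiable_one_div_Gamma (L * s)
  unfold gammaRatio
  refine DifferentiableAt.mul ?_ ?_
  · exact h1.comp s (by fun_prop)
  · exact h2.comp s (by fun_prop)

/-- The numerator decays like `e^{-θK|Im s|}` and the reciprocal Gamma grows at most like
`e^{(π-θ)L|Im s|}`. For `θ` close to `π/2` the decay wins because `L < K`. -/
theorem exists_norm_gammaRatio_le (hL : L < K) {c₀ c₁ : ℝ} (hc : 0 < K * c₀ + b) :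
    ∃ C δ : ℝ, 0 < δ ∧ ∀ s : ℂ, s.re ∈ Set.Icc c₀ c₁ →
      ‖gammaRatio K L b s‖ ≤ C * Real.exp (-(δ * |s.im|)) := by
  have hpi := Real.pi_pos
  have hK0 : (0 : ℝ) < K := by exact_mod_cast (Nat.zero_le L).trans_lt hL
  have hLK : (L : ℝ) < K := by exact_mod_cast hL
  have hL0 : (0 : ℝ) ≤ L := L.cast_nonneg
  -- The lower bound is exactly positivity of the net rate `θ K - (π - θ) L`.
  obtain ⟨θ, hθ1, hθ2⟩ : ∃ θ : ℝ, Real.pi * L / (K + L) < θ ∧ θ < Real.pi / 2 := by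
    refine exists_between ?_
    rw [div_lt_div_iff₀ (by linarith) two_pos]
    nlinarith
  rw [div_lt_iff₀ (by linarith)] at hθ1
  have hθ0 : 0 ≤ θ := by
    by_contra h
    have : 0 ≤ Real.pi * L := by positivity
    nlinarith
  set δ := θ * K - (Real.pi - θ) * L with hδ
  have hδ0 : 0 < δ := by rw [hδ]; linarith
  obtain ⟨C₁, hC₁0, hC₁⟩ := exists_norm_Gamma_le hθ0 hθ2 (a := K * c₀ + b) (b := K * c₁ + b) hc
  obtain ⟨C₂, hC₂0, hC₂⟩ := exists_norm_inv_Gamma_le hθ0 hθ2 (L * c₀) (L * c₁)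
  -- Near the real axis the bound on `1/Γ` is unavailable; compactness replaces it there.
  have hcont : ContinuousOn (gammaRatio K L b) (Set.Icc c₀ c₁ ×ℂ Set.Icc (-1) 1) := by
    intro s hs
    have h1 := (Complex.mem_reProdIm.1 hs).1.1
    have : K * c₀ ≤ K * s.re := by gcongr
    exact (differentiableAt_gammaRatio (by linarith)).continuousAt.continuousWithinAt
  obtain ⟨C₃, hC₃⟩ := (isCompact_Icc.reProdIm isCompact_Icc).exists_bound_of_continuousOn hcont
  have hbig : ∀ s : ℂ, s.re ∈ Set.Icc c₀ c₁ → 1 ≤ |(L * s).im| →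
      ‖gammaRatio K L b s‖ ≤ C₁ * C₂ * Real.exp (-(δ * |s.im|)) := by
    intro s hs him
    have h1 := hC₁ (K * s + b) (by
      simp only [Complex.add_re, Complex.ofReal_re, natCast_mul_re]
      exact ⟨by nlinarith [hs.1], by nlinarith [hs.2]⟩)
    have h2 := hC₂ (L * s) (by
      simp only [natCast_mul_re]
      exact ⟨by nlinarith [hs.1], by nlinarith [hs.2]⟩) him
    simp only [Complex.add_im, Complex.ofReal_im, natCast_mul_im, add_zero, abs_mul,
      Nat.abs_cast] at h1 h2
    rw [gammaRatio, norm_mul]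
    refine (mul_le_mul h1 h2 (norm_nonneg _) (by positivity)).trans (le_of_eq ?_)
    rw [mul_mul_mul_comm, ← Real.exp_add, hδ]
    congr 2
    ring
  refine ⟨C₁ * C₂ + |C₃| * Real.exp δ, δ, hδ0, fun s hs => ?_⟩
  have hC₃0 := abs_nonneg C₃
  rcases le_or_gt 1 |s.im| with h | h
  · rcases Nat.eq_zero_or_pos L with rfl | hLp
    · have : gammaRatio K 0 b s = 0 := by simp [gammaRatio]
      rw [this, norm_zero]
      positivity
    · have hL1 : (1 : ℝ) ≤ L := by exact_mod_cast hLp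
      refine (hbig s hs ?_).trans ?_
      · rw [natCast_mul_im, abs_mul, Nat.abs_cast]
        nlinarith
      · gcongr
        have : 0 ≤ |C₃| * Real.exp δ := by positivity
        linarith
  · have h1 := hC₃ s (Complex.mem_reProdIm.2 ⟨hs, abs_le.1 h.le⟩)
    have h2 : 1 ≤ Real.exp δ * Real.exp (-(δ * |s.im|)) := by
      rw [← Real.exp_add]
      exact Real.one_le_exp (by nlinarith)
    have h3 : 0 ≤ C₁ * C₂ * Real.exp (-(δ * |s.im|)) := by positivity
    calc ‖gammaRatio K L b s‖ ≤ |C₃| * 1 := by rw [mul_one]; exact h1.trans (le_abs_self _)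
      _ ≤ |C₃| * (Real.exp δ * Real.exp (-(δ * |s.im|))) := by gcongr
      _ ≤ _ := by rw [add_mul, mul_assoc |C₃|]; linarith

theorem integrable_exp_neg_mul_abs {δ : ℝ} (hδ : 0 < δ) :
    Integrable fun y : ℝ => Real.exp (-(δ * |y|)) := by
  have := integrable_exp_neg_mul_abs_rpow one_pos hδ
  simpa using this

theorem verticalIntegrable_gammaRatio (hL : L < K) {c : ℝ} (hc : 0 < K * c + b) :
    Complex.VerticalIntegrable (gammaRatio K L b) c := by
  obtain ⟨C, δ, hδ, h⟩ := exists_norm_gammaRatio_le (c₁ := c) hL hc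
  refine ((integrable_exp_neg_mul_abs hδ).const_mul C).mono'
    (Continuous.aestronglyMeasurable ?_) (.of_forall fun y => ?_)
  · refine continuous_iff_continuousAt.2 fun y => ?_
    have h1 : ContinuousAt (gammaRatio K L b) ((c : ℂ) + y * Complex.I) :=
      (differentiableAt_gammaRatio (by simpa using hc)).continuousAt
    exact h1.comp (f := fun y : ℝ => (c : ℂ) + y * Complex.I) (by fun_prop)
  · have := h ((c : ℂ) + y * Complex.I) (by simp)
    simpa using this

/-- Writing `s = i w` turns the line `Re s = c` into `Im w = -c`, so strip Cauchy applies; all poles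
of the numerator lie to the left of both lines. -/
theorem mellinInv_gammaRatio_eq (hL : L < K) {c₀ c₁ Y : ℝ} (hY : 0 < Y)
    (hc₀ : 0 < K * c₀ + b) (hc₁ : 0 < K * c₁ + b) :
    mellinInv c₀ (gammaRatio K L b) Y = mellinInv c₁ (gammaRatio K L b) Y := by
  have hYc : (Y : ℂ) ≠ 0 := by exact_mod_cast hY.ne'
  have hmin : 0 < K * min c₀ c₁ + b := by
    rcases min_choice c₀ c₁ with h | h <;> rw [h] <;> assumption
  obtain ⟨C, δ, hδ, h⟩ := exists_norm_gammaRatio_le (c₁ := max c₀ c₁) hL hmin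
  set F : ℂ → ℂ := fun w => (Y : ℂ) ^ (-(Complex.I * w)) * gammaRatio K L b (Complex.I * w) with hF
  set D : ℝ := max (Y ^ (-c₀)) (Y ^ (-c₁)) with hD
  have hre : ∀ y ∈ Set.uIcc (-c₀) (-c₁), -y ∈ Set.Icc (min c₀ c₁) (max c₀ c₁) := by
    intro y hy
    rw [Set.mem_uIcc] at hy
    rcases hy with hy | hy
    · exact ⟨(min_le_right _ _).trans (by linarith), le_trans (by linarith) (le_max_left _ _)⟩
    · exact ⟨(min_le_left _ _).trans (by linarith), le_trans (by linarith) (le_max_right _ _)⟩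
  have hYD : ∀ y ∈ Set.uIcc (-c₀) (-c₁), Y ^ y ≤ D := by
    intro y hy
    rw [Set.mem_uIcc] at hy
    rcases le_total 1 Y with h1 | h1 <;> rcases hy with hy | hy
    · exact (Real.rpow_le_rpow_of_exponent_le h1 hy.2).trans (le_max_right _ _)
    · exact (Real.rpow_le_rpow_of_exponent_le h1 hy.2).trans (le_max_left _ _)
    · exact (Real.rpow_le_rpow_of_exponent_ge hY h1 hy.1).trans (le_max_left _ _)
    · exact (Real.rpow_le_rpow_of_exponent_ge hY h1 hy.1).trans (le_max_right _ _)
  have hImre : ∀ w : ℂ, (Complex.I * w).re = -w.im := fun w => by simp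
  have hstrip := integral_eq_of_strip (F := F) (a := -c₀) (b := -c₁)
    (g := fun v => D * C * Real.exp (-(δ * |v|))) ?_ ?_ ?_ ?_ ?_
  · have e : ∀ c : ℝ, mellinInv c (gammaRatio K L b) Y =
        (1 / (2 * Real.pi)) • ∫ v : ℝ, F (v + (-c : ℝ) * Complex.I) := by
      intro c
      rw [mellinInv]
      congr 1
      refine integral_congr_ae (.of_forall fun v => ?_)
      have : Complex.I * ((v : ℂ) + (-c : ℝ) * Complex.I) = c + v * Complex.I := by
        push_cast
        linear_combination (-c : ℂ) * Complex.I_sq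
      simp only [hF, this, smul_eq_mul]
    rw [e, e, hstrip]
  · intro w hw
    have h1 : -w.im ∈ Set.Icc (min c₀ c₁) (max c₀ c₁) := hre _ hw
    have h2 : DifferentiableAt ℂ (gammaRatio K L b) (Complex.I * w) := by
      refine differentiableAt_gammaRatio ?_
      rw [hImre]
      have : K * min c₀ c₁ ≤ K * -w.im := mul_le_mul_of_nonneg_left h1.1 K.cast_nonneg
      linarith
    have h3 : DifferentiableAt ℂ (fun w : ℂ => gammaRatio K L b (Complex.I * w)) w :=
      h2.comp w (by fun_prop)
    have h4 : DifferentiableAt ℂ (fun w : ℂ => (Y : ℂ) ^ (-(Complex.I * w))) w :=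
      DifferentiableAt.const_cpow (by fun_prop) (Or.inl hYc)
    exact (h4.mul h3).differentiableWithinAt
  · intro y hy v
    have e1 : (Complex.I * ((v : ℂ) + y * Complex.I)).re = -y := by simp
    have e2 : (Complex.I * ((v : ℂ) + y * Complex.I)).im = v := by simp
    have h1 := h (Complex.I * (v + y * Complex.I)) (by rw [e1]; exact hre y hy)
    rw [e2] at h1
    have h2 := hYD y hy
    rw [hF, norm_mul, Complex.norm_cpow_eq_rpow_re_of_pos hY, Complex.neg_re, e1, neg_neg, mul_assoc]
    exact mul_le_mul h2 h1 (norm_nonneg _) ((Real.rpow_nonneg hY.le _).trans h2)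
  · exact (integrable_exp_neg_mul_abs hδ).const_mul _
  · have h0 : Tendsto (fun v : ℝ => Real.exp (-(δ * |v|))) atTop (𝓝 0) :=
      Real.tendsto_exp_atBot.comp (tendsto_neg_atTop_atBot.comp
        (tendsto_abs_atTop_atTop.const_mul_atTop hδ))
    simpa using h0.const_mul (D * C)
  · have h0 : Tendsto (fun v : ℝ => Real.exp (-(δ * |v|))) atBot (𝓝 0) :=
      Real.tendsto_exp_atBot.comp (tendsto_neg_atTop_atBot.comp
        (tendsto_abs_atBot_atTop.const_mul_atTop hδ))
    simpa using h0.const_mul (D * C)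

end

/-! ### The Mellin transform of the inverse Laplace transform -/

section

variable {p q : ℂ} {M ρ : ℝ}

/-- The integral `∫₀^∞ u^ρ e^{-p x u - q u^M} du` in the variable `u = e^v`. -/
noncomputable def laplaceIntegral (p q : ℂ) (M ρ x : ℝ) : ℂ :=
  ∫ v : ℝ, Complex.exp ((1 + ρ) * v - p * x * Complex.exp v - q * Complex.exp (M * v))

theorem continuousAt_laplaceIntegral (hp : 0 < p.re) (hq : 0 < q.re) (hM : 0 < M) (hρ : 0 ≤ ρ)
    {x : ℝ} (hx : 0 < x) : ContinuousAt (laplaceIntegral p q M ρ) x := by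
  have hb := integrable_cexp_mul_sub_exp (a := 1 + ρ) (r := q) (by simp; linarith) hq hM
  unfold laplaceIntegral
  refine continuousAt_of_dominated (bound := fun v : ℝ =>
    ‖Complex.exp ((1 + ρ) * v - q * Complex.exp (M * v))‖) ?_ ?_ hb.norm ?_
  · exact .of_forall fun x => Continuous.aestronglyMeasurable (by fun_prop)
  · filter_upwards [eventually_gt_nhds hx] with y hy
    refine .of_forall fun v => ?_
    rw [Complex.norm_exp, Complex.norm_exp]
    refine Real.exp_le_exp.2 ?_
    simp only [Complex.sub_re]
    have : (p * y * Complex.exp v).re = p.re * y * Real.exp v := by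
      rw [← Complex.ofReal_exp, Complex.re_mul_ofReal, Complex.re_mul_ofReal]
    rw [this]
    have : 0 ≤ p.re * y * Real.exp v := by positivity
    linarith
  · exact .of_forall fun v => Continuous.continuousAt (by fun_prop)

theorem exp_smul_mellin_integrand (f : ℝ → ℂ) (s : ℂ) (y : ℝ) :
    (Real.exp y : ℂ) * (((Real.exp y : ℝ) : ℂ) ^ (s - 1) * f (Real.exp y)) =
      Complex.exp (s * y) * f (Real.exp y) := by
  rw [Complex.cpow_def_of_ne_zero (by exact_mod_cast (Real.exp_pos y).ne'), ← Complex.ofReal_log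
    (Real.exp_pos y).le, Real.log_exp, ← mul_assoc]
  push_cast
  rw [← Complex.exp_add]
  congr 2
  ring

theorem mellin_eq_integral_exp (f : ℝ → ℂ) (s : ℂ) :
    mellin f s = ∫ y : ℝ, Complex.exp (s * y) * f (Real.exp y) := by
  rw [mellin, integral_Ioi_eq_integral_exp]
  simp only [smul_eq_mul, exp_smul_mellin_integrand]

theorem mellinConvergent_iff_integrable_exp (f : ℝ → ℂ) (s : ℂ) :
    MellinConvergent f s ↔ Integrable fun y : ℝ => Complex.exp (s * y) * f (Real.exp y) := by
  rw [MellinConvergent, integrableOn_Ioi_iff_integrable_exp]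
  simp only [smul_eq_mul, Complex.real_smul, exp_smul_mellin_integrand]

theorem integral_cexp_mul_sub_exp_mul {a r : ℂ} (ha : 0 < a.re) (hr : 0 < r.re) (hM : 0 < M) :
    ∫ v : ℝ, Complex.exp (a * v - r * Complex.exp (M * v)) =
      (1 / M : ℂ) * (Complex.exp (-(a / M * Complex.log r)) * Complex.Gamma (a / M)) := by
  have hMc : (M : ℂ) ≠ 0 := by exact_mod_cast hM.ne'
  have h := Measure.integral_comp_mul_left
    (fun v : ℝ => Complex.exp (a / M * v - r * Complex.exp v)) M
  rw [integral_cexp_mul_sub_exp (by rw [Complex.div_ofReal_re]; positivity) hr,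
    abs_of_pos (by positivity), Complex.real_smul] at h
  push_cast at h
  rw [one_div, ← h]
  refine integral_congr_ae (.of_forall fun v => ?_)
  simp only
  rw [← mul_assoc (a / M), div_mul_cancel₀ _ hMc]

/-- Integrating over `x` first gives `∫ x^{s-1} e^{-pxu} dx = p^{-s} u^{-s} Γ(s)`, and what remains
is again a Gamma integral, in `u^M`. -/
theorem hasMellin_laplaceIntegral (hp : 0 < p.re) (hq : 0 < q.re) (hM : 0 < M) (hρ : 0 ≤ ρ)
    {s : ℂ} (hs0 : 0 < s.re) (hs1 : s.re < 1) :
    HasMellin (laplaceIntegral p q M ρ) s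
      (Complex.exp (-(s * Complex.log p)) * Complex.Gamma s * ((1 / M : ℂ) *
        (Complex.exp (-((1 + ρ - s) / M * Complex.log q)) *
          Complex.Gamma ((1 + ρ - s) / M)))) := by
  set f : ℝ → ℝ → ℂ := fun v y => Complex.exp (s * y) * Complex.exp ((1 + ρ) * v -
    p * (Real.exp y : ℝ) * Complex.exp v - q * Complex.exp (M * v)) with hf
  have ha : 0 < ((1 : ℂ) + ρ - s).re := by simp; linarith
  -- In logarithmic variables the double integrand is a product in `v` and `y + v`, so translation
  -- invariance separates the two integrals.
  have hsplit : ∀ v y : ℝ, f v y = Complex.exp (((1 : ℂ) + ρ - s) * v - q * Complex.exp (M * v)) *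
      Complex.exp (s * ((y + v : ℝ) : ℂ) - p * Complex.exp ((y + v : ℝ) : ℂ)) := by
    intro v y
    simp only [hf]
    rw [← Complex.exp_add, ← Complex.exp_add]
    congr 1
    push_cast
    rw [Complex.exp_add (y : ℂ)]
    ring
  have hA := integrable_cexp_mul_sub_exp ha hq hM
  have hB : Integrable fun y : ℝ => Complex.exp (s * y - p * Complex.exp y) := by
    have := integrable_cexp_mul_sub_exp (M := 1) hs0 hp one_pos
    simpa using this
  have hinner : ∀ v : ℝ, ∫ y : ℝ, f v y =
      Complex.exp (((1 : ℂ) + ρ - s) * v - q * Complex.exp (M * v)) *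
        (Complex.exp (-(s * Complex.log p)) * Complex.Gamma s) := by
    intro v
    simp only [hsplit]
    rw [integral_const_mul, integral_add_right_eq_self (μ := volume)
      (fun y : ℝ => Complex.exp (s * y - p * Complex.exp y)), integral_cexp_mul_sub_exp hs0 hp]
  have hmeas : AEStronglyMeasurable (Function.uncurry f) (volume.prod volume) :=
    Continuous.aestronglyMeasurable (by simp only [hf, Function.uncurry_def]; fun_prop)
  have hint : Integrable (Function.uncurry f) (volume.prod volume) := by
    rw [integrable_prod_iff hmeas]
    refine ⟨.of_forall fun v => ?_, ?_⟩
    · simp only [Function.uncurry_apply_pair, hsplit]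
      exact (hB.comp_add_right v).const_mul _
    · simp only [Function.uncurry_apply_pair, hsplit, norm_mul, integral_const_mul]
      refine (hA.norm.mul_const (∫ y : ℝ, ‖Complex.exp (s * y - p * Complex.exp y)‖)).congr
        (.of_forall fun v => ?_)
      simp only
      rw [integral_add_right_eq_self (μ := volume)
        (fun y : ℝ => ‖Complex.exp (s * y - p * Complex.exp y)‖)]
  have hswap : (fun y : ℝ => Complex.exp (s * y) * laplaceIntegral p q M ρ (Real.exp y)) =
      fun y => ∫ v : ℝ, f v y := by
    funext y
    rw [laplaceIntegral, ← integral_const_mul]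
  constructor
  · rw [mellinConvergent_iff_integrable_exp, hswap]
    exact hint.integral_prod_right
  · rw [mellin_eq_integral_exp, hswap, ← integral_integral_swap hint]
    simp only [hinner]
    rw [integral_mul_const, integral_cexp_mul_sub_exp_mul ha hq hM]
    ring

end

section

variable {M ρ t : ℝ}

theorem conj_laplaceIntegral (p q : ℂ) (M ρ x : ℝ) :
    (starRingEnd ℂ) (laplaceIntegral p q M ρ x) =
      laplaceIntegral ((starRingEnd ℂ) p) ((starRingEnd ℂ) q) M ρ x := by
  rw [laplaceIntegral, laplaceIntegral, ← integral_conj]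
  simp only [← Complex.exp_conj, map_sub, map_mul, map_add, map_one, Complex.conj_ofReal]

theorem rayIntegral_eq_laplaceIntegral (x t M m ρ θ : ℝ) :
    rayIntegral x t 0 M m ρ θ = Complex.exp (-(Complex.I * θ * (1 + ρ))) *
      laplaceIntegral (-Complex.exp (-(Complex.I * θ))) (t * Complex.exp (-(Complex.I * (M * θ))))
        M ρ x := by
  rw [rayIntegral, laplaceIntegral, ← integral_const_mul]
  refine integral_congr_ae (.of_forall fun v => ?_)
  simp only [logIntegrand]
  rw [← Complex.exp_add]
  congr 1
  have e1 : Complex.exp (v + (-θ : ℝ) * Complex.I) =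
      Complex.exp v * Complex.exp (-(Complex.I * θ)) := by
    rw [← Complex.exp_add]; congr 1; push_cast; ring
  have e2 : Complex.exp (M * (v + (-θ : ℝ) * Complex.I)) =
      Complex.exp (M * v) * Complex.exp (-(Complex.I * (M * θ))) := by
    rw [← Complex.exp_add]; congr 1; push_cast; ring
  rw [e1, e2]
  push_cast
  ring

theorem exists_angle (hM0 : 0 < M) (hM1 : M < 1) :
    ∃ θ : ℝ, Real.pi / 2 < θ ∧ θ < Real.pi ∧ M * θ < Real.pi / 2 := by
  have hpi := Real.pi_pos
  have h : Real.pi / 2 < min Real.pi (Real.pi / 2 / M) := by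
    refine lt_min (by linarith) ?_
    rw [lt_div_iff₀ hM0]
    nlinarith
  obtain ⟨θ, h1, h2⟩ := exists_between h
  refine ⟨θ, h1, h2.trans_le (min_le_left _ _), ?_⟩
  have := h2.trans_le (min_le_right _ _)
  rwa [lt_div_iff₀ hM0, mul_comm] at this

/-- The inverse Laplace transform of `s^ρ e^{-t s^M}`. -/
noncomputable def invLaplace (t M ρ x : ℝ) : ℝ :=
  -(1 / Real.pi) * (rayIntegral x t 0 M M ρ Real.pi).im

/-- On the negative half-line itself `e^{-t s^M}` may grow, since `cos πM` can be negative. At an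
angle slightly beyond `π/2` both `e^{xs}` and `e^{-t s^M}` decay, so `p` and `q` have positive real
part; the imaginary part is then written as `J` minus its conjugate. -/
theorem exists_invLaplace_eq (ht : 0 < t) (hM0 : 0 < M) (hM1 : M < 1) (hρ : 0 ≤ ρ) :
    ∃ (θ : ℝ) (p q : ℂ), 0 < p.re ∧ 0 < q.re ∧ Complex.log p = (Real.pi - θ) * Complex.I ∧
      Complex.log q = Real.log t - M * θ * Complex.I ∧
      Complex.log ((starRingEnd ℂ) p) = -((Real.pi - θ) * Complex.I) ∧
      Complex.log ((starRingEnd ℂ) q) = Real.log t + M * θ * Complex.I ∧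
      ∀ x : ℝ, 0 < x → (invLaplace t M ρ x : ℂ) = Complex.I / (2 * Real.pi) *
        (Complex.exp (-(Complex.I * θ * (1 + ρ))) * laplaceIntegral p q M ρ x -
          Complex.exp (Complex.I * θ * (1 + ρ)) *
            laplaceIntegral ((starRingEnd ℂ) p) ((starRingEnd ℂ) q) M ρ x) := by
  have hpi := Real.pi_pos
  obtain ⟨θ, h1, h2, h3⟩ := exists_angle hM0 hM1
  set p : ℂ := -Complex.exp (-(Complex.I * θ)) with hp
  set q : ℂ := t * Complex.exp (-(Complex.I * (M * θ))) with hq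
  have hp' : p = Complex.exp ((Real.pi - θ : ℝ) * Complex.I) := by
    rw [hp, Complex.ofReal_sub, sub_mul, sub_eq_add_neg, Complex.exp_add, Complex.exp_pi_mul_I,
      neg_one_mul, mul_comm Complex.I]
  have hq' : q = Complex.exp (Real.log t + (-(M * θ) : ℝ) * Complex.I) := by
    rw [hq, Complex.exp_add, ← Complex.ofReal_exp, Real.exp_log ht]
    congr 2
    push_cast
    ring
  have hMθ : 0 < M * θ := by have : 0 < θ := by linarith
                             positivity
  have hlogp : Complex.log p = (Real.pi - θ) * Complex.I := by
    rw [hp', Complex.log_exp] <;> simp <;> linarith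
  have hlogq : Complex.log q = Real.log t - M * θ * Complex.I := by
    rw [hq', Complex.log_exp]
    · push_cast; ring
    · simp; linarith
    · simp; linarith
  have hpre : 0 < p.re := by
    rw [hp', Complex.exp_ofReal_mul_I_re]
    exact Real.cos_pos_of_mem_Ioo ⟨by linarith, by linarith⟩
  have hqre : 0 < q.re := by
    rw [hq', Complex.exp_add, ← Complex.ofReal_exp, Real.exp_log ht, Complex.re_ofReal_mul,
      Complex.exp_ofReal_mul_I_re, Real.cos_neg]
    exact mul_pos ht (Real.cos_pos_of_mem_Ioo ⟨by linarith, h3⟩)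
  have harg : ∀ z : ℂ, 0 < z.re → z.arg ≠ Real.pi := by
    intro z hz h
    have := Complex.abs_arg_lt_pi_div_two_iff.2 (Or.inl hz)
    rw [h, abs_of_pos hpi] at this
    linarith
  refine ⟨θ, p, q, hpre, hqre, hlogp, hlogq, ?_, ?_, fun x hx => ?_⟩
  · rw [Complex.log_conj _ (harg p hpre), hlogp]
    simp
  · rw [Complex.log_conj _ (harg q hqre), hlogq]
    simp only [map_sub, map_mul, Complex.conj_ofReal, Complex.conj_I]
    ring
  · have hJ := rayIntegral_eq_laplaceIntegral x t M M ρ θ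
    rw [rayIntegral_eq_pi ht le_rfl hM0 hM1 hM0 hM1 hρ hx ⟨h1.le, h2.le⟩, ← hp, ← hq] at hJ
    have hJ' := congrArg (starRingEnd ℂ) hJ
    rw [map_mul, conj_laplaceIntegral, ← Complex.exp_conj] at hJ'
    have e : (starRingEnd ℂ) (-(Complex.I * θ * (1 + ρ))) = Complex.I * θ * (1 + ρ) := by
      simp
    rw [e] at hJ'
    rw [← hJ, ← hJ', Complex.sub_conj, invLaplace]
    have hp0 : (Real.pi : ℂ) ≠ 0 := by exact_mod_cast hpi.ne'
    push_cast
    field_simp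
    rw [Complex.I_sq]
    ring

theorem continuousAt_invLaplace (ht : 0 < t) (hM0 : 0 < M) (hM1 : M < 1) (hρ : 0 ≤ ρ) {x : ℝ}
    (hx : 0 < x) : ContinuousAt (fun x => (invLaplace t M ρ x : ℂ)) x := by
  obtain ⟨θ, p, q, hp, hq, -, -, -, -, h⟩ := exists_invLaplace_eq ht hM0 hM1 hρ
  have h1 := continuousAt_laplaceIntegral hp hq hM0 hρ hx
  have h2 := continuousAt_laplaceIntegral (p := (starRingEnd ℂ) p) (q := (starRingEnd ℂ) q)
    (by simpa using hp) (by simpa using hq) hM0 hρ hx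
  have h3 : ContinuousAt (fun x => Complex.I / (2 * Real.pi) *
      (Complex.exp (-(Complex.I * θ * (1 + ρ))) * laplaceIntegral p q M ρ x -
        Complex.exp (Complex.I * θ * (1 + ρ)) *
          laplaceIntegral ((starRingEnd ℂ) p) ((starRingEnd ℂ) q) M ρ x)) x :=
    continuousAt_const.mul ((continuousAt_const.mul h1).sub (continuousAt_const.mul h2))
  refine h3.congr ?_
  filter_upwards [eventually_gt_nhds hx] with y hy
  exact (h y hy).symm

theorem HasMellin.congr_Ioi {f g : ℝ → ℂ} {s m : ℂ} (hf : HasMellin f s m)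
    (hfg : ∀ x, 0 < x → g x = f x) : HasMellin g s m := by
  constructor
  · have h1 : IntegrableOn (fun x : ℝ => (x : ℂ) ^ (s - 1) • f x) (Set.Ioi 0) := hf.1
    exact h1.congr_fun (fun x hx => by rw [hfg x hx]) measurableSet_Ioi
  · rw [← hf.2]
    exact setIntegral_congr_fun measurableSet_Ioi fun x hx => by rw [hfg x hx]

/-- The auxiliary angle cancels: the two conjugate halves carry the phases `e^{∓iπs}`, their
difference gives `sin πs`, and reflection converts `Γ(s) sin(πs) / π` into `1 / Γ(1 - s)`. -/
theorem hasMellin_invLaplace (ht : 0 < t) (hM0 : 0 < M) (hM1 : M < 1) (hρ : 0 ≤ ρ) {s : ℂ}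
    (hs0 : 0 < s.re) (hs1 : s.re < 1) :
    HasMellin (fun x => (invLaplace t M ρ x : ℂ)) s
      ((1 / M : ℂ) * (Complex.exp (-((1 + ρ - s) / M * Real.log t)) *
        Complex.Gamma ((1 + ρ - s) / M)) * (Complex.Gamma (1 - s))⁻¹) := by
  obtain ⟨θ, p, q, hp, hq, hlp, hlq, hlp', hlq', h⟩ := exists_invLaplace_eq ht hM0 hM1 hρ
  have h1 := hasMellin_laplaceIntegral hp hq hM0 hρ hs0 hs1
  have h2 := hasMellin_laplaceIntegral (p := (starRingEnd ℂ) p) (q := (starRingEnd ℂ) q)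
    (by simpa using hp) (by simpa using hq) hM0 hρ hs0 hs1
  have h1' := hasMellin_const_smul h1.1 (Complex.exp (-(Complex.I * θ * (1 + ρ))))
  have h2' := hasMellin_const_smul h2.1 (Complex.exp (Complex.I * θ * (1 + ρ)))
  have h3 := hasMellin_sub h1'.1 h2'.1
  have h4 := hasMellin_const_smul h3.1 (Complex.I / (2 * Real.pi))
  rw [h3.2, h1'.2, h2'.2, h1.2, h2.2, hlp, hlq, hlp', hlq'] at h4
  have h5 := HasMellin.congr_Ioi (g := fun x => (invLaplace t M ρ x : ℂ)) h4 fun x hx => by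
    simpa only [smul_eq_mul] using h x hx
  convert! h5 using 1
  have hMc : (M : ℂ) ≠ 0 := by exact_mod_cast hM0.ne'
  have hpc : (Real.pi : ℂ) ≠ 0 := by exact_mod_cast Real.pi_ne_zero
  have hΓs : Complex.Gamma s ≠ 0 := Complex.Gamma_ne_zero_of_re_pos hs0
  have hΓ1 : Complex.Gamma (1 - s) ≠ 0 := Complex.Gamma_ne_zero_of_re_pos (by simpa using hs1)
  have hrefl := Complex.Gamma_mul_Gamma_one_sub s
  have hsin : Complex.sin (Real.pi * s) ≠ 0 := by
    intro h
    rw [h, div_zero] at hrefl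
    exact mul_ne_zero hΓs hΓ1 hrefl
  have hinv : (Complex.Gamma (1 - s))⁻¹ = Complex.Gamma s * Complex.sin (Real.pi * s) / Real.pi := by
    rw [eq_div_iff hsin] at hrefl
    rw [eq_div_iff hpc, inv_mul_eq_iff_eq_mul₀ hΓ1]
    linear_combination -hrefl
  have e1 : Complex.exp (-(Complex.I * θ * (1 + ρ))) *
      (Complex.exp (-(s * ((Real.pi - θ) * Complex.I))) *
        Complex.exp (-((1 + ρ - s) / M * (Real.log t - M * θ * Complex.I)))) =
      Complex.exp (-((1 + ρ - s) / M * Real.log t)) *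
        Complex.exp (-(Real.pi * s) * Complex.I) := by
    rw [← Complex.exp_add, ← Complex.exp_add, ← Complex.exp_add]
    congr 1
    field_simp
    ring
  have e2 : Complex.exp (Complex.I * θ * (1 + ρ)) *
      (Complex.exp (-(s * -((Real.pi - θ) * Complex.I))) *
        Complex.exp (-((1 + ρ - s) / M * (Real.log t + M * θ * Complex.I)))) =
      Complex.exp (-((1 + ρ - s) / M * Real.log t)) *
        Complex.exp (Real.pi * s * Complex.I) := by
    rw [← Complex.exp_add, ← Complex.exp_add, ← Complex.exp_add]
    congr 1
    field_simp
    ring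
  rw [hinv, Complex.sin]
  simp only [smul_eq_mul]
  linear_combination (-(Complex.I / (2 * Real.pi)) * Complex.Gamma s * (1 / M) *
    Complex.Gamma ((1 + ρ - s) / M)) * (e1 - e2)

end

section

variable {K L : ℕ} {M ρ t x b : ℝ}

/-- Replacing the Mellin variable by `1 - L s` turns `Γ((1 + ρ - ·)/M) / Γ(1 - ·)` into `Γ(Ks + b) /
Γ(Ls)`, thanks to `M K = L`. On the function side this is multiplication by `x` and the substitution
`y = t^K / x^L`, after which Mellin inversion applies. -/
theorem mellinInv_gammaRatio (ht : 0 < t) (hx : 0 < x) (hM0 : 0 < M) (hM1 : M < 1) (hρ : 0 ≤ ρ)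
    (hL : 0 < L) (hLK : L < K) (hM : M * K = L) (hb : b = ρ / M) {c : ℝ} (hc : 0 < K * c + b) :
    mellinInv c (gammaRatio K L b) ((t ^ K / x ^ L : ℝ)) =
      ((t ^ b / K * x * invLaplace t M ρ x : ℝ) : ℂ) := by
  have hL0 : (0 : ℝ) < L := by exact_mod_cast hL
  have hK0 : (0 : ℝ) < K := by exact_mod_cast hL.trans hLK
  have hY : 0 < t ^ K / x ^ L := by positivity
  have hb0 : 0 ≤ b := by rw [hb]; positivity
  -- This puts `1 - L s` on the line `Re = 1/2`, inside the strip where the Mellin transform is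
  -- known.
  set c₁ : ℝ := 1 / (2 * L) with hc₁
  have hc₁0 : 0 < c₁ := by positivity
  rw [mellinInv_gammaRatio_eq hLK hY hc (c₁ := c₁) (by positivity)]
  set W : ℝ → ℂ := fun u => (u : ℂ) ^ (1 : ℂ) • (invLaplace t M ρ u : ℂ) with hW
  set V : ℝ → ℂ := fun u => W (u ^ (-1 / (L : ℝ))) with hV
  have htK : 0 < (t ^ K)⁻¹ := by positivity
  set f : ℝ → ℂ := fun y => ((t ^ b / K : ℝ) : ℂ) • V ((t ^ K)⁻¹ * y) with hf
  have ha : (-1 / (L : ℝ)) ≠ 0 := div_ne_zero (by norm_num) hL0.ne'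
  have hLc : (L : ℂ) ≠ 0 := by exact_mod_cast hL0.ne'
  have hKc : (K : ℂ) ≠ 0 := by exact_mod_cast hK0.ne'
  have hMc : (M : ℂ) ≠ 0 := by exact_mod_cast hM0.ne'
  have hsa : ∀ s : ℂ, s / ((-1 / (L : ℝ) : ℝ) : ℂ) + 1 = 1 - L * s := by
    intro s
    push_cast
    field_simp
    ring
  have hre : ∀ s : ℂ, s.re = c₁ → (1 - L * s).re = 1 / 2 := by
    intro s hs
    rw [Complex.sub_re, natCast_mul_re, hs, hc₁, Complex.one_re]
    field_simp
    norm_num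
  have hmel := fun (s : ℂ) (hs : s.re = c₁) => hasMellin_invLaplace (s := 1 - L * s) ht hM0 hM1 hρ
    (by rw [hre s hs]; norm_num) (by rw [hre s hs]; norm_num)
  have hconv : MellinConvergent f c₁ := by
    refine MellinConvergent.const_smul ?_ _
    rw [MellinConvergent.comp_mul_left htK, hV, MellinConvergent.comp_rpow ha, hW,
      MellinConvergent.cpow_smul, hsa]
    exact (hmel c₁ (by simp)).1
  have hval : ∀ s : ℂ, s.re = c₁ → mellin f s = gammaRatio K L b s := by
    intro s hs
    rw [hf, mellin_const_smul, mellin_comp_mul_left _ _ htK, hV, mellin_comp_rpow, hW,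
      mellin_cpow_smul, hsa, (hmel s hs).2, gammaRatio, sub_sub_cancel]
    have e1 : ((1 : ℂ) + ρ - (1 - L * s)) / M = K * s + b := by
      have : (L : ℂ) = M * K := by exact_mod_cast hM.symm
      rw [hb, this]
      push_cast
      field_simp
      ring
    have e2 : (((t ^ K)⁻¹ : ℝ) : ℂ) ^ (-s) = Complex.exp (K * s * Real.log t) := by
      rw [Complex.cpow_def_of_ne_zero (by exact_mod_cast htK.ne'), ← Complex.ofReal_log htK.le,
        Real.log_inv, Real.log_pow]
      push_cast
      congr 1
      ring
    have e3 : ((t ^ b : ℝ) : ℂ) = Complex.exp (b * Real.log t) := by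
      rw [Real.rpow_def_of_pos ht]
      push_cast
      congr 1
      ring
    have e4 : |(-1 / (L : ℝ))|⁻¹ = L := by
      rw [abs_div, abs_neg, abs_one, Nat.abs_cast, one_div, inv_inv]
    have e5 : Complex.exp (b * Real.log t) * Complex.exp (K * s * Real.log t) *
        Complex.exp (-((K * s + b) * Real.log t)) = 1 := by
      rw [← Complex.exp_add, ← Complex.exp_add, ← Complex.exp_zero]
      congr 1
      ring
    have e6 : (1 : ℂ) / K * L * (1 / M) = 1 := by
      have : (L : ℂ) = M * K := by exact_mod_cast hM.symm
      rw [this]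
      field_simp
    rw [e1, e2, e4]
    simp only [smul_eq_mul, Complex.real_smul]
    push_cast
    rw [e3]
    linear_combination (Complex.Gamma (K * s + b) * (Complex.Gamma (L * s))⁻¹) *
      ((1 : ℂ) / K * L * (1 / M)) * e5 +
      (Complex.Gamma (K * s + b) * (Complex.Gamma (L * s))⁻¹) * e6
  have hline : ∀ y : ℝ, mellin f (c₁ + y * Complex.I) = gammaRatio K L b (c₁ + y * Complex.I) :=
    fun y => hval _ (by simp)
  have hvert : Complex.VerticalIntegrable (mellin f) c₁ := by
    have := verticalIntegrable_gammaRatio (b := b) hLK (c := c₁) (by positivity)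
    simpa only [Complex.VerticalIntegrable, hline] using this
  have hxL : ((t ^ K)⁻¹ * (t ^ K / x ^ L)) ^ (-1 / (L : ℝ)) = x := by
    have e : (t ^ K)⁻¹ * (t ^ K / x ^ L) = (x ^ (L : ℝ))⁻¹ := by
      rw [Real.rpow_natCast]; field_simp
    rw [e, ← Real.rpow_neg hx.le, ← Real.rpow_mul hx.le]
    have : -(L : ℝ) * (-1 / L) = 1 := by field_simp
    rw [this, Real.rpow_one]
  have hcont : ContinuousAt f (t ^ K / x ^ L) := by
    have h1 : ContinuousAt (fun y : ℝ => ((t ^ K)⁻¹ * y) ^ (-1 / (L : ℝ))) (t ^ K / x ^ L) :=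
      ContinuousAt.rpow_const (by fun_prop) (Or.inl (by positivity))
    have h2 : ContinuousAt W x := by
      simp only [hW, Complex.cpow_one]
      have h3 : ContinuousAt (fun u : ℝ => (u : ℂ)) x := Complex.continuous_ofReal.continuousAt
      exact h3.smul (continuousAt_invLaplace ht hM0 hM1 hρ hx)
    have h4 : ContinuousAt (fun y => V ((t ^ K)⁻¹ * y)) (t ^ K / x ^ L) :=
      ContinuousAt.comp_of_eq (g := W) h2 h1 hxL
    exact h4.const_smul ((t ^ b / K : ℝ) : ℂ)
  have hfin := mellinInv_mellin_eq c₁ f hY hconv hvert hcont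
  have e : mellinInv c₁ (mellin f) (t ^ K / x ^ L) =
      mellinInv c₁ (gammaRatio K L b) (t ^ K / x ^ L) := by
    simp only [mellinInv, hline]
  rw [← e, hfin]
  simp only [hf, hV, hW, hxL, Complex.cpow_one, smul_eq_mul]
  push_cast
  ring

end

/-! ### The Meijer function -/

section

variable {K L : ℕ} {b : ℝ}

/-- The constant that Gauss's multiplication formula produces in the Meijer kernel. -/
noncomputable def meijerConst (K L : ℕ) (b : ℝ) : ℝ :=
  √(2 * Real.pi) ^ (K - 1) * √(K : ℝ) / (√(2 * Real.pi) ^ (L - 1) * √(L : ℝ)) *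
    (K : ℝ) ^ (-b)

/-- Two of the four products are empty, and Gauss's formula collapses the other two. Its powers
combine to `K^{-(Ks+b)} L^{Ls} = K^{-b} (L^L / K^K)^s`, which explains the factor `L^L / K^K` in
`κ`. -/
theorem meijerKernel_unifPart (hL : 0 < L) (hK : 0 < K) (b : ℝ) (s : ℂ) :
    meijerKernel K 0 (fun i => ((unifPart L 0 i : ℝ) : ℂ)) (fun i => ((unifPart K b i : ℝ) : ℂ)) s =
      meijerConst K L b * ((((L : ℝ) ^ L / (K : ℝ) ^ K : ℝ) : ℂ) ^ s * gammaRatio K L b s) := by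
  have hL0 : (0 : ℝ) < L := by exact_mod_cast hL
  have hK0 : (0 : ℝ) < K := by exact_mod_cast hK
  have hLc : (L : ℂ) ≠ 0 := by exact_mod_cast hL.ne'
  have hKc : (K : ℂ) ≠ 0 := by exact_mod_cast hK.ne'
  have h1 : ∏ j : Fin K with j.val < K, Complex.Gamma (((unifPart K b j : ℝ) : ℂ) + s) =
      ∏ j ∈ Finset.range K, Complex.Gamma ((s + b / K) + (j : ℂ) / K) := by
    rw [Finset.filter_true_of_mem fun j _ => j.2, Finset.prod_range]
    refine Finset.prod_congr rfl fun j _ => ?_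
    congr 1
    simp only [unifPart]
    push_cast
    ring
  have h2 : ∏ j : Fin L with 0 ≤ j.val, Complex.Gamma (((unifPart L 0 j : ℝ) : ℂ) + s) =
      ∏ j ∈ Finset.range L, Complex.Gamma (s + (j : ℂ) / L) := by
    rw [Finset.filter_true_of_mem fun j _ => Nat.zero_le _, Finset.prod_range]
    refine Finset.prod_congr rfl fun j _ => ?_
    congr 1
    simp only [unifPart]
    push_cast
    ring
  have h3 : ∀ f : Fin L → ℂ, ∏ j : Fin L with j.val < 0, f j = 1 := fun f => by simp
  have h4 : ∀ f : Fin K → ℂ, ∏ j : Fin K with K ≤ j.val, f j = 1 := fun f => by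
    rw [Finset.filter_false_of_mem fun j _ => not_le.2 j.2, Finset.prod_empty]
  rw [meijerKernel, h1, h2, h3, h4, mul_one, one_mul, prod_Gamma_add_div K hK,
    prod_Gamma_add_div L hL, gammaRatio, meijerConst]
  have e1 : (K : ℂ) * (s + b / K) = K * s + b := by field_simp
  have hlog : ∀ n : ℕ, Complex.log (n : ℂ) = ((Real.log n : ℝ) : ℂ) := fun n => by
    rw [Complex.natCast_log]
  have e2 : (((L : ℝ) ^ L / (K : ℝ) ^ K : ℝ) : ℂ) ^ s =
      Complex.exp (s * (L * Real.log L - K * Real.log K)) := by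
    have hp : 0 < (L : ℝ) ^ L / (K : ℝ) ^ K := by positivity
    rw [Complex.cpow_def_of_ne_zero (by exact_mod_cast hp.ne'), ← Complex.ofReal_log hp.le,
      Real.log_div (by positivity) (by positivity), Real.log_pow, Real.log_pow]
    push_cast
    congr 1
    ring
  have e3 : (((K : ℝ) ^ (-b) : ℝ) : ℂ) = Complex.exp (-(b * Real.log K)) := by
    rw [Real.rpow_def_of_pos hK0]
    push_cast
    congr 1
    ring
  have e4 : (K : ℂ) ^ (-((K : ℂ) * s + b)) =
      Complex.exp (-(b * Real.log K)) * Complex.exp (-(s * K * Real.log K)) := by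
    rw [Complex.cpow_def_of_ne_zero hKc, hlog, ← Complex.exp_add]
    congr 1
    ring
  have e5 : (L : ℂ) ^ (-((L : ℂ) * s)) = (Complex.exp (s * L * Real.log L))⁻¹ := by
    rw [Complex.cpow_def_of_ne_zero hLc, hlog, ← Complex.exp_neg]
    congr 1
    ring
  have e6 : Complex.exp (s * (L * Real.log L - K * Real.log K)) =
      Complex.exp (s * L * Real.log L) * Complex.exp (-(s * K * Real.log K)) := by
    rw [← Complex.exp_add]
    congr 1
    ring
  rw [e1, e4, e5, e2, e6]
  push_cast [e3]
  simp only [div_eq_mul_inv, mul_inv, inv_inv]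
  ring

/-- Among the points of `Δ(K, b)` the smallest, `b / K`, gives the only binding condition. -/
theorem isMeijerContour_unifPart_iff (hK : 0 < K) (c : ℝ) :
    IsMeijerContour K 0 (fun i : Fin L => ((unifPart L 0 i : ℝ) : ℂ))
      (fun i => ((unifPart K b i : ℝ) : ℂ)) c ↔ 0 < K * c + b := by
  have hK0 : (0 : ℝ) < K := by exact_mod_cast hK
  constructor
  · rintro ⟨h, -⟩
    have := h ⟨0, hK⟩ hK
    simp only [unifPart, Complex.ofReal_re, Nat.cast_zero, add_zero] at this
    rw [← neg_div, div_lt_iff₀ hK0] at this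
    linarith
  · intro h
    refine ⟨fun j _ => ?_, fun j hj => absurd hj (Nat.not_lt_zero _)⟩
    simp only [unifPart, Complex.ofReal_re]
    rw [← neg_div, div_lt_iff₀ hK0]
    have : (0 : ℝ) ≤ (j : ℕ) := Nat.cast_nonneg _
    linarith

theorem verticalIntegrable_meijerKernel_unifPart (hL : 0 < L) (hLK : L < K) {c : ℝ}
    (hc : 0 < K * c + b) :
    Complex.VerticalIntegrable (meijerKernel K 0 (fun i => ((unifPart L 0 i : ℝ) : ℂ))
      (fun i => ((unifPart K b i : ℝ) : ℂ))) c := by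
  have hL0 : (0 : ℝ) < L := by exact_mod_cast hL
  have hK0 : (0 : ℝ) < K := by exact_mod_cast hL.trans hLK
  have hE : 0 < (L : ℝ) ^ L / (K : ℝ) ^ K := by positivity
  have h := verticalIntegrable_gammaRatio hLK hc
  rw [Complex.VerticalIntegrable] at h ⊢
  simp only [meijerKernel_unifPart hL (hL.trans hLK)]
  refine (h.bdd_mul (c := ((L : ℝ) ^ L / (K : ℝ) ^ K) ^ c) ?_ (.of_forall fun y => ?_)).const_mul _
  · refine Continuous.aestronglyMeasurable ?_
    exact Continuous.const_cpow (by fun_prop) (Or.inl (by exact_mod_cast hE.ne'))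
  · rw [Complex.norm_cpow_eq_rpow_re_of_pos hE]
    simp

theorem mellinInv_meijerKernel_unifPart (hL : 0 < L) (hLK : L < K) (c : ℝ) {Y : ℝ} (hY : 0 < Y) :
    mellinInv c (meijerKernel K 0 (fun i => ((unifPart L 0 i : ℝ) : ℂ))
      (fun i => ((unifPart K b i : ℝ) : ℂ))) ((L : ℝ) ^ L / (K : ℝ) ^ K * Y) =
      meijerConst K L b * mellinInv c (gammaRatio K L b) Y := by
  have hL0 : (0 : ℝ) < L := by exact_mod_cast hL
  have hK0 : (0 : ℝ) < K := by exact_mod_cast hL.trans hLK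
  set E : ℝ := (L : ℝ) ^ L / (K : ℝ) ^ K with hEdef
  have hE : 0 < E := by positivity
  simp only [mellinInv, smul_eq_mul, Complex.real_smul]
  rw [mul_left_comm, ← integral_const_mul (meijerConst K L b : ℂ)]
  congr 1
  refine integral_congr_ae (.of_forall fun y => ?_)
  simp only [meijerKernel_unifPart hL (hL.trans hLK), ← hEdef]
  generalize (c : ℂ) + y * Complex.I = s
  have e : ((E * Y : ℝ) : ℂ) ^ (-s) = ((E : ℂ) ^ s)⁻¹ * (Y : ℂ) ^ (-s) := by
    rw [Complex.ofReal_mul, Complex.mul_cpow_ofReal_nonneg hE.le hY.le, Complex.cpow_neg (E : ℂ)]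
  have hne : (E : ℂ) ^ s ≠ 0 := by
    rw [Complex.cpow_def_of_ne_zero (by exact_mod_cast hE.ne')]
    exact Complex.exp_ne_zero _
  rw [e]
  field_simp

variable {M ρ t x : ℝ}

theorem mellinInv_meijerKernel_eq (ht : 0 < t) (hx : 0 < x) (hM0 : 0 < M) (hM1 : M < 1)
    (hρ : 0 ≤ ρ) (hL : 0 < L) (hLK : L < K) (hM : M * K = L) (hb : b = ρ / M) {c : ℝ}
    (hc : 0 < K * c + b) :
    mellinInv c (meijerKernel K 0 (fun i => ((unifPart L 0 i : ℝ) : ℂ))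
      (fun i => ((unifPart K b i : ℝ) : ℂ))) ((L : ℝ) ^ L / (K : ℝ) ^ K * (t ^ K / x ^ L)) =
      ((meijerConst K L b * (t ^ b / K * x * invLaplace t M ρ x) : ℝ) : ℂ) := by
  rw [mellinInv_meijerKernel_unifPart hL hLK c (by positivity),
    mellinInv_gammaRatio ht hx hM0 hM1 hρ hL hLK hM hb hc, ← Complex.ofReal_mul]

theorem meijerG_unifPart (ht : 0 < t) (hx : 0 < x) (hM0 : 0 < M) (hM1 : M < 1)
    (hρ : 0 ≤ ρ) (hL : 0 < L) (hLK : L < K) (hM : M * K = L) (hb : b = ρ / M) :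
    MeijerGConverges K 0 (fun i : Fin L => ((unifPart L 0 i : ℝ) : ℂ))
      (fun i => ((unifPart K b i : ℝ) : ℂ)) ((L : ℝ) ^ L / (K : ℝ) ^ K * (t ^ K / x ^ L)) ∧
    meijerG K 0 (fun i : Fin L => ((unifPart L 0 i : ℝ) : ℂ))
      (fun i => ((unifPart K b i : ℝ) : ℂ)) ((L : ℝ) ^ L / (K : ℝ) ^ K * (t ^ K / x ^ L)) =
      ((meijerConst K L b * (t ^ b / K * x * invLaplace t M ρ x) : ℝ) : ℂ) := by
  have hK := hL.trans hLK
  have hb0 : 0 ≤ b := by rw [hb]; positivity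
  have hex : ∃ c : ℝ, IsMeijerContour K 0 (fun i : Fin L => ((unifPart L 0 i : ℝ) : ℂ))
      (fun i => ((unifPart K b i : ℝ) : ℂ)) c := by
    refine ⟨1, (isMeijerContour_unifPart_iff hK 1).2 ?_⟩
    have : (0 : ℝ) < K := by exact_mod_cast hK
    linarith
  -- The contour picked by `Classical.epsilon` is admissible because one exists, and the computed
  -- value does not mention the abscissa.
  have hG := mellinInv_meijerKernel_eq ht hx hM0 hM1 hρ hL hLK hM hb
    ((isMeijerContour_unifPart_iff hK _).1 (Classical.epsilon_spec hex))
  refine ⟨⟨hex, fun c hc => ?_⟩, hG⟩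
  have hc' := (isMeijerContour_unifPart_iff hK c).1 hc
  refine ⟨verticalIntegrable_meijerKernel_unifPart hL hLK hc', ?_⟩
  rw [mellinInv_meijerKernel_eq ht hx hM0 hM1 hρ hL hLK hM hb hc']
  exact hG.symm

/-- Everything cancels: the powers of `2π` match, `√K / √L = 1 / √M`, and `(K/t)^b K^{-b} t^b = 1`.
-/
theorem prefactor_mul_meijerConst (ht : 0 < t) (hx : 0 < x) (hL : 0 < L) (hLK : L < K)
    (hM : M * K = L) (hM0 : 0 < M) (u g : ℝ) :
    x⁻¹ * K * √M / (2 * Real.pi) ^ (((K : ℝ) - (L : ℝ)) / 2) * u * ((K : ℝ) / t) ^ b *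
      (meijerConst K L b * (t ^ b / K * x * g)) = u * g := by
  have hL0 : (0 : ℝ) < L := by exact_mod_cast hL
  have hK0 : (0 : ℝ) < K := by exact_mod_cast hL.trans hLK
  obtain ⟨d, rfl⟩ : ∃ d, K = L + d := ⟨K - L, by omega⟩
  obtain ⟨L, rfl⟩ : ∃ d, L = d + 1 := ⟨L - 1, by omega⟩
  set K : ℕ := L + 1 + d with hK
  have e1 : (2 * Real.pi) ^ (((K : ℝ) - ((L + 1 : ℕ) : ℝ)) / 2) = √(2 * Real.pi) ^ d := by
    rw [Real.sqrt_eq_rpow, ← Real.rpow_mul_natCast (by positivity)]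
    congr 1
    rw [hK]
    push_cast
    ring
  have e2 : √(2 * Real.pi) ^ (K - 1) = √(2 * Real.pi) ^ L * √(2 * Real.pi) ^ d := by
    rw [← pow_add]; congr 1; omega
  have e3 : √(((L + 1 : ℕ) : ℝ)) = √M * √(K : ℝ) := by
    rw [← hM, Real.sqrt_mul hM0.le]
  have e4 : ((K : ℝ) / t) ^ b * (K : ℝ) ^ (-b) * t ^ b = 1 := by
    rw [Real.div_rpow hK0.le ht.le, Real.rpow_neg hK0.le]
    have := Real.rpow_pos_of_pos hK0 b
    have := Real.rpow_pos_of_pos ht b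
    field_simp
  have hs2 : √(2 * Real.pi) ≠ 0 := by have := Real.pi_pos; positivity
  have hsM : √M ≠ 0 := by positivity
  have hsK : √(K : ℝ) ≠ 0 := by positivity
  rw [meijerConst, e1, e2, e3, Nat.add_sub_cancel]
  calc _ = u * g * (((K : ℝ) / t) ^ b * (K : ℝ) ^ (-b) * t ^ b) := by
        field_simp
    _ = u * g := by rw [e4, mul_one]

end

/-! ### Summation over `r` and assembly -/

/-- The `r`-th term of the series is `(-t)^r / r!` times an inverse Laplace transform. -/
theorem hasSum_invLaplace {t x M m : ℝ} (ht : 0 < t) (hx : 0 < x) (hM0 : 0 < M) (hM1 : M < 1)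
    (hm0 : 0 < m) (hm1 : m < 1) :
    HasSum (fun r : ℕ => (-t) ^ r / (r.factorial : ℝ) * invLaplace t M (m * r) x)
      (-(1 / Real.pi) * (rayIntegral x t t M m 0 Real.pi).im) := by
  have h := (hasSum_rayIntegral_pi hx ht.le ht.le hM0 hM1 hm0 hm1 le_rfl).2
  -- Making `r` the outer index, the inner sum over `n` is the single series for `ρ = m r`.
  rw [← (Equiv.prodComm ℕ ℕ).hasSum_iff] at h
  refine h.prod_fiberwise fun r => ?_
  have h1 := (hasSum_rayIntegral_pi (m := M) (ρ := m * r) hx ht.le le_rfl hM0 hM1 hM0 hM1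
    (by positivity)).2
  have hinj : Function.Injective fun n : ℕ => (n, 0) := fun a b hab => by simpa using hab
  rw [← hinj.hasSum_iff] at h1
  swap
  · intro i hi
    have : i.2 ≠ 0 := fun h0 => hi ⟨i.1, by rw [← h0]⟩
    simp [this]
  refine (h1.mul_left ((-t) ^ r / (r.factorial : ℝ))).congr_fun fun n => ?_
  have e : (0 : ℝ) + M * n + m * r = m * r + M * n + M * (0 : ℕ) := by push_cast; ring
  simp only [Function.comp_apply, Equiv.prodComm_apply, Prod.swap_prod_mk, e, pow_zero,
    Nat.factorial_zero, Nat.cast_one, mul_one]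
  field_simp

end TwoScaleLevy

theorem mainTheorem6 (l k p q : ℕ) (hl : 0 < l) (hlk : l < k) (hp : 0 < p) (hpq : p < q)
    (hne : (l : ℝ) / k ≠ (p : ℝ) / q) (t x : ℝ) (ht : 0 < t) (hx : 0 < x)
    (m M : ℝ) (hm : m = min ((l : ℝ) / k) ((p : ℝ) / q))
    (hM : M = max ((l : ℝ) / k) ((p : ℝ) / q))
    (m₁ : ℕ) (hm₁ : m₁ = min (k * p) (l * q))
    (κ : ℝ)
    (hκ : κ = ((l * p : ℕ) : ℝ) ^ (l * p) / (m₁ : ℝ) ^ m₁ * (t ^ (1 / M) / x) ^ (l * p)) :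
    -- every hypergeometric series that occurs converges (absolutely)
    (∀ r n : ℕ, n < m₁ →
      Summable (TwoScaleLevy.hypTerm
        (Fin.cons 1 (TwoScaleLevy.unifPart (l * p) (1 + M * n + m * r)) : Fin (l * p + 1) → ℝ)
        (TwoScaleLevy.unifPart m₁ (1 + n))
        ((-1) ^ ((m₁ : ℤ) - ((l * p : ℕ) : ℤ)) * κ))) ∧
    -- the series in `r` of finite sums of hypergeometric functions
    HasSum (fun r : ℕ =>
      -(1 / Real.pi) * ∑ n ∈ Finset.range m₁,
        (-t) ^ (n + r) / ((Nat.factorial n : ℝ) * (Nat.factorial r : ℝ)) *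
          (Real.Gamma (1 + M * n + m * r) / x ^ (1 + M * n + m * r)) *
          Real.sin (Real.pi * M * n + Real.pi * m * r) *
          TwoScaleLevy.hypF
            (Fin.cons 1 (TwoScaleLevy.unifPart (l * p) (1 + M * n + m * r)) :
              Fin (l * p + 1) → ℝ)
            (TwoScaleLevy.unifPart m₁ (1 + n))
            ((-1) ^ ((m₁ : ℤ) - ((l * p : ℕ) : ℤ)) * κ))
      (TwoScaleLevy.twoScaleDensity ((l : ℝ) / k) ((p : ℝ) / q) t x) ∧
    -- every Meijer function that occurs is given by an absolutely convergent contour integral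
    (∀ r : ℕ, TwoScaleLevy.MeijerGConverges m₁ 0
      (fun i => ((TwoScaleLevy.unifPart (l * p) 0 i : ℝ) : ℂ))
      (fun i => ((TwoScaleLevy.unifPart m₁ (m / M * r) i : ℝ) : ℂ)) κ) ∧
    -- the series in `r` of Meijer functions
    HasSum (fun r : ℕ =>
      ((x⁻¹ * m₁ * √M / (2 * Real.pi) ^ (((m₁ : ℝ) - ((l * p : ℕ) : ℝ)) / 2) *
          ((-t) ^ r / (Nat.factorial r : ℝ)) * ((m₁ : ℝ) / t) ^ (m / M * r) : ℝ) : ℂ) *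
        TwoScaleLevy.meijerG m₁ 0
          (fun i => ((TwoScaleLevy.unifPart (l * p) 0 i : ℝ) : ℂ))
          (fun i => ((TwoScaleLevy.unifPart m₁ (m / M * r) i : ℝ) : ℂ)) κ)
      ((TwoScaleLevy.twoScaleDensity ((l : ℝ) / k) ((p : ℝ) / q) t x : ℝ) : ℂ) := by
  have hl0 : (0 : ℝ) < l := by exact_mod_cast hl
  have hp0 : (0 : ℝ) < p := by exact_mod_cast hp
  have hk0 : (0 : ℝ) < k := by exact_mod_cast hl.trans hlk
  have hq0 : (0 : ℝ) < q := by exact_mod_cast hp.trans hpq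
  have ha0 : (0 : ℝ) < (l : ℝ) / k := by positivity
  have hb0 : (0 : ℝ) < (p : ℝ) / q := by positivity
  have ha1 : (l : ℝ) / k < 1 := by rw [div_lt_one hk0]; exact_mod_cast hlk
  have hb1 : (p : ℝ) / q < 1 := by rw [div_lt_one hq0]; exact_mod_cast hpq
  have hM0 : 0 < M := by rw [hM]; exact lt_max_of_lt_left ha0
  have hM1 : M < 1 := by rw [hM]; exact max_lt ha1 hb1
  have hm0 : 0 < m := by rw [hm]; exact lt_min ha0 hb0
  have hm1 : m < 1 := by rw [hm]; exact min_lt_of_left_lt ha1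
  have hL : 0 < l * p := Nat.mul_pos hl hp
  -- The maximum `M` and the minimum `m₁` are decided by the same comparison of `kp` with `lq`, so
  -- their product is `lp` in either case.
  have hMK : M * m₁ = (l * p : ℕ) := by
    rcases le_total (k * p) (l * q) with h | h
    · have h' : (p : ℝ) / q ≤ (l : ℝ) / k := by
        rw [div_le_div_iff₀ hq0 hk0, mul_comm (p : ℝ)]
        exact_mod_cast h
      rw [hM, hm₁, max_eq_left h', min_eq_left h]
      push_cast
      field_simp
    · have h' : (l : ℝ) / k ≤ (p : ℝ) / q := by
        rw [div_le_div_iff₀ hk0 hq0, mul_comm (p : ℝ)]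
        exact_mod_cast h
      rw [hM, hm₁, max_eq_right h', min_eq_right h]
      push_cast
      field_simp
  have hK : 0 < m₁ := by
    rw [hm₁]
    exact lt_min (Nat.mul_pos (hl.trans hlk) hp) (Nat.mul_pos hl (hp.trans hpq))
  have hK0 : (0 : ℝ) < m₁ := by exact_mod_cast hK
  have hLK : l * p < m₁ := by
    rw [hm₁]
    exact lt_min (Nat.mul_lt_mul_of_pos_right hlk hp) (Nat.mul_lt_mul_of_pos_left hpq hl)
  -- By `M m₁ = lp`, the power `(t^{1/M})^{lp}` is the integral power `t^{m₁}`.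
  have hκ' : κ = ((l * p : ℕ) : ℝ) ^ (l * p) / (m₁ : ℝ) ^ m₁ * (t ^ m₁ / x ^ (l * p)) := by
    rw [hκ, div_pow, ← Real.rpow_mul_natCast ht.le]
    congr 2
    rw [← hMK, one_div, inv_mul_cancel_left₀ hM0.ne', Real.rpow_natCast]
  have hsgn : |(-1 : ℝ) ^ ((m₁ : ℤ) - ((l * p : ℕ) : ℤ))| = 1 := by
    rw [abs_zpow, abs_neg, abs_one, one_zpow]
  have hmax := TwoScaleLevy.twoScaleDensity_eq_max_min ht ha0 ha1 hb0 hb1 hx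
  rw [← hM, ← hm] at hmax
  have hser := TwoScaleLevy.hasSum_invLaplace ht hx hM0 hM1 hm0 hm1
  rw [← hmax] at hser
  have hexp : ∀ r n : ℕ, 1 + M * (n : ℝ) + m * r = 1 + (m * r + M * n) := fun r n => by ring
  have hρ : ∀ r : ℕ, 0 ≤ m * (r : ℝ) := fun r => by positivity
  have hmeijer := fun r : ℕ => TwoScaleLevy.meijerG_unifPart (b := m / M * r) ht hx hM0 hM1 (hρ r)
    hL hLK hMK (by ring)
  rw [← hκ'] at hmeijer
  refine ⟨fun r n _ => ?_, ?_, fun r => (hmeijer r).1, ?_⟩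
  · rw [hexp]
    exact TwoScaleLevy.summable_hypTerm ht hM0 hM1 hL hK hMK hx hκ' (hρ r) hsgn n
  · refine hser.congr_fun fun r => ?_
    rw [TwoScaleLevy.invLaplace,
      (TwoScaleLevy.rayIntegral_eq_sum_hypF ht hM0 hM1 hL hK hMK hx hκ' (hρ r) hM0 hM1).2,
      mul_left_comm ((-t) ^ r / (r.factorial : ℝ))]
    congr 1
    rw [Finset.mul_sum]
    refine Finset.sum_congr rfl fun n _ => ?_
    have e : Real.pi * M * n + Real.pi * m * r = Real.pi * (m * r + M * n) := by ring
    rw [hexp, e, pow_add]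
    field_simp
  · have hserC := Complex.hasSum_ofReal.2 hser
    refine hserC.congr_fun fun r => ?_
    rw [(hmeijer r).2, ← Complex.ofReal_mul,
      TwoScaleLevy.prefactor_mul_meijerConst ht hx hL hLK hMK hM0]
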